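/- Let $S=\mathbb C[X_1,\dots,X_n]$, graded by $\deg X_j=1$, and let $W$ be a finite group all of whose finite-dimensional complex representations are self-dual. Let $W$ act on $S$ by $\mathbb C$-algebra automorphisms preserving the grading, put $R=S^W$, and assume that $S/(S\cdot R_{>0})$ is finite-dimensional. Let $A=S*W$ be the skew group algebra, i.e. $S\otimes_{\mathbb C}\mathbb CW$ with $(s\otimes w)(s'\otimes w')=s\,w(s')\otimes ww'$, graded by $A_i=S_i\otimes\mathbb CW$. All graded $A$-modules are $\mathbb Z$-graded left modules; $M\langle d\rangle$ is the shift with $M\langle d\rangle_i=M_{i-d}$, and $\operatorname{Hom}_A(M,N)_d$ is the space of $A$-linear maps $f$ with $f(M_i)\subseteq N_{i+d}$ for all $i$. For finitely generated graded modules, $\operatorname{Ext}^i_A(M,N)_d$ is the $i$-th cohomology of $\operatorname{Hom}_A(Q_\bullet,N)_d$ for a projective resolution $Q_\bullet\to M$ by finitely generated graded modules. Let $\operatorname{Irr}W$ be the set of isomorphism classes of irreducible complex representations of $W$. For $\lambda\in\operatorname{Irr}W$ let $P_\lambda=S\otimes_{\mathbb C}\lambda$, with $(P_\lambda)_i=S_i\otimes\lambda$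 and $(s\otimes w)(p\otimes v)=s\,w(p)\otimes w(v)$. Fix a preorder $\precsim$ on $\operatorname{Irr}W$, write $\lambda\prec\mu$ if $\lambda\precsim\mu$ and not $\mu\precsim\lambda$, and set $$K_\lambda=P_\lambda\Big/\sum_{\mu\succsim\lambda,\ d>0,\ f\in\operatorname{Hom}_A(P_\mu,P_\lambda)_d}\operatorname{Im}f,\qquad \widetilde K_\lambda=P_\lambda\Big/\sum_{\mu\succ\lambda,\ d>0,\ f\in\operatorname{Hom}_A(P_\mu,P_\lambda)_d}\operatorname{Im}f .$$ The module $K_\lambda$ is finite-dimensional; its dual $K_\lambda^*=\operatorname{Hom}_{\mathbb C}(K_\lambda,\mathbb C)$ is the graded left $A$-module with $((s\otimes w)f)(m)=f((w^{-1}(s)\otimes w^{-1})m)$ and $(K_\lambda^*)_i=\operatorname{Hom}_{\mathbb C}((K_\lambda)_{-i},\mathbb C)$. Put $[K_\mu:L_\lambda]_q=\sum_{d\in\mathbb Z}q^d[(K_\mu)_d:\lambda]$, where $[(K_\mu)_d:\lambda]$ is the multiplicity of $\lambda$ in the $W$-representation $(K_\mu)_d$. A $\widetilde K$-filtration of a finitely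 generated graded $A$-module $M$ is a sequence of graded submodules $M=M^0\supseteq M^1\supseteq M^2\supseteq\cdots$ with $\bigcap_iM^i=0$, each of whose factors $M^{i-1}/M^i$ is zero or isomorphic, as a graded module, to $\widetilde K_\mu\langle d\rangle$ for some $\mu\in\operatorname{Irr}W$ and $d\in\mathbb Z$. The multiplicity of $\widetilde K_\mu$ in it is $\sum_{d\in\mathbb Z}m_{\mu,d}\,q^d$, where $m_{\mu,d}$ is the number of factors isomorphic to $\widetilde K_\mu\langle d\rangle$. Assume that for all $\lambda,\mu\in\operatorname{Irr}W$, $i\ge 0$ and $d\in\mathbb Z$ $$\operatorname{Ext}^i_A(\widetilde K_\lambda,K_\mu^*)_d\cong\begin{cases}\mathbb C&(i=d=0\text{ and }\lambda=\mu),\\0&(\text{otherwise}).\end{cases}$$ Then for every finitely generated graded $A$-module $M$, every $\widetilde K$-filtration of $M$ and every $\mu\in\operatorname{Irr}W$, the multiplicity of $\widetilde K_\mu$ in the filtration is a well-defined formal Laurent series in $q$ (all $m_{\mu,d}$ are finite, and they vanish for $d\ll0$), and it equals $$\sum_{d\in\mathbb Z}q^d\dim_{\mathbb C}\operatorname{Hom}_A(M,K_\mu^*)_{-d}.$$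 In particular all $\widetilde K$-filtrations of $M$ have the same multiplicities. Moreover, for all $\lambda,\mu\in\operatorname{Irr}W$ such that $P_\lambda$ has a $\widetilde K$-filtration, the multiplicity $(P_\lambda:\widetilde K_\mu)_q$ of $\widetilde K_\mu$ in any such filtration satisfies $$(P_\lambda:\widetilde K_\mu)_q=[K_\mu:L_\lambda]_q .$$ -/

import Mathlib

universe u

noncomputable section

/-! ## Graded modules over a graded `ℂ`-algebra -/

section GradingHelpers

variable {M : Type u} [AddCommGroup M] [Module ℂ M]

/-- A family of subspaces that spans and admits projections is a direct sum decomposition. -/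
theorem isInternal_of_proj (gr : ℤ → Submodule ℂ M) (π : ℤ → M →ₗ[ℂ] M)
    (h2 : ∀ i, ∀ x ∈ gr i, π i x = x)
    (h3 : ∀ i j, i ≠ j → ∀ x ∈ gr i, π j x = 0)
    (hsup : ⨆ i, gr i = ⊤) : DirectSum.IsInternal gr := by
  refine (DirectSum.isInternal_submodule_iff_iSupIndep_and_iSup_eq_top gr).2 ⟨?_, hsup⟩
  refine iSupIndep_def.2 fun i => Submodule.disjoint_def.2 fun x hx hx' => ?_
  rw [← h2 i x hx]
  have : (⨆ j, ⨆ (_ : j ≠ i), gr j) ≤ LinearMap.ker (π i) :=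
    iSup_le fun j => iSup_le fun hj y hy => h3 j i hj y hy
  exact this hx'

/-- The projection onto the degree `i` part of a direct sum decomposition. -/
def gradedProj (gr : ℤ → Submodule ℂ M) (h : DirectSum.IsInternal gr) (i : ℤ) : M →ₗ[ℂ] M :=
  (gr i).subtype ∘ₗ DirectSum.component ℂ ℤ (fun j => gr j) i ∘ₗ
    (LinearEquiv.ofBijective (DirectSum.coeLinearMap gr) h).symm.toLinearMap

variable {gr : ℤ → Submodule ℂ M} (h : DirectSum.IsInternal gr)

theorem gradedProj_mem (i : ℤ) (x : M) : gradedProj gr h i x ∈ gr i := by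
  simp [gradedProj]

theorem symm_of_mem {i : ℤ} {x : M} (hx : x ∈ gr i) :
    (LinearEquiv.ofBijective (DirectSum.coeLinearMap gr) h).symm x =
      DirectSum.lof ℂ ℤ (fun j => gr j) i ⟨x, hx⟩ := by
  rw [LinearEquiv.symm_apply_eq]
  exact (DirectSum.coeLinearMap_lof gr i ⟨x, hx⟩).symm

theorem gradedProj_same {i : ℤ} {x : M} (hx : x ∈ gr i) : gradedProj gr h i x = x := by
  simp [gradedProj, symm_of_mem h hx, DirectSum.component.lof_self]

theorem gradedProj_ne {i j : ℤ} (hij : i ≠ j) {x : M} (hx : x ∈ gr i) :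
    gradedProj gr h j x = 0 := by
  simp [gradedProj, symm_of_mem h hx, DirectSum.component.of, hij]

theorem iSup_gr (h : DirectSum.IsInternal gr) : ⨆ i, gr i = ⊤ := h.submodule_iSup_eq_top

theorem mem_of_gradedProj {N : Submodule ℂ M} {x : M} (hx : ∀ i, gradedProj gr h i x ∈ N) :
    x ∈ N := by
  classical
  obtain ⟨y, rfl⟩ := (LinearEquiv.ofBijective (DirectSum.coeLinearMap gr) h).surjective x
  have key : ∀ i, gradedProj gr h i (LinearEquiv.ofBijective (DirectSum.coeLinearMap gr) h y) =
      (y i : M) := by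
    intro i
    simp only [gradedProj, LinearMap.comp_apply, LinearEquiv.coe_coe,
      LinearEquiv.symm_apply_apply]
    rfl
  simp only [key] at hx
  have : (LinearEquiv.ofBijective (DirectSum.coeLinearMap gr) h) y = ∑ i ∈ y.support, (y i : M) := by
    exact DirectSum.coeLinearMap_eq_dfinsuppSum gr y
  rw [this]
  exact N.sum_mem fun i _ => hx i

theorem exists_finset_sum (x : M) : ∃ s : Finset ℤ, x = ∑ i ∈ s, gradedProj gr h i x := by
  classical
  obtain ⟨y, rfl⟩ := (LinearEquiv.ofBijective (DirectSum.coeLinearMap gr) h).surjective x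
  refine ⟨y.support, ?_⟩
  have key : ∀ i, gradedProj gr h i (LinearEquiv.ofBijective (DirectSum.coeLinearMap gr) h y) =
      (y i : M) := by
    intro i
    simp only [gradedProj, LinearMap.comp_apply, LinearEquiv.coe_coe,
      LinearEquiv.symm_apply_apply]
    rfl
  simp only [key]
  exact DirectSum.coeLinearMap_eq_dfinsuppSum gr y

end GradingHelpers

section GradedModules

/-- A graded left module `M = ⨁ M_i` over a `ℂ`-algebra `A` with homogeneous parts `𝒜 i`. -/
structure GrMod {A : Type u} [Ring A] [Algebra ℂ A] (𝒜 : ℤ → Submodule ℂ A) :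
    Type (u + 1) where
  carrier : Type u
  [grp : AddCommGroup carrier]
  [modC : Module ℂ carrier]
  [modA : Module A carrier]
  [tower : IsScalarTower ℂ A carrier]
  gr : ℤ → Submodule ℂ carrier
  internal : DirectSum.IsInternal gr
  smul_mem : ∀ {i j : ℤ} {a : A} {m : carrier}, a ∈ 𝒜 i → m ∈ gr j → a • m ∈ gr (i + j)

attribute [instance] GrMod.grp GrMod.modC GrMod.modA GrMod.tower

variable {A : Type u} [Ring A] [Algebra ℂ A] {𝒜 : ℤ → Submodule ℂ A}

instance : CoeSort (GrMod 𝒜) (Type u) := ⟨GrMod.carrier⟩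

namespace GrMod

instance (M : GrMod 𝒜) : SMulCommClass A ℂ M := IsScalarTower.to_smulCommClass'

/-- The homogeneous component of degree `i` of an element. -/
def proj (M : GrMod 𝒜) (i : ℤ) : M →ₗ[ℂ] M := gradedProj M.gr M.internal i

/-- Being finitely generated over `A`. -/
def FG (M : GrMod 𝒜) : Prop := Module.Finite A M

/-- `homDeg M N d` is `Hom_A(M, N)_d`: the `A`-linear maps `f` with `f(M_i) ⊆ N_{i+d}`. -/
def homDeg (M N : GrMod 𝒜) (d : ℤ) : Submodule ℂ (M →ₗ[A] N) where
  carrier := {f | ∀ i, ∀ m ∈ M.gr i, f m ∈ N.gr (i + d)}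
  add_mem' hf hg i m hm := (N.gr _).add_mem (hf i m hm) (hg i m hm)
  zero_mem' _ _ _ := (N.gr _).zero_mem
  smul_mem' c _ hf i m hm := (N.gr _).smul_mem c (hf i m hm)

/-- Isomorphism in the category of graded modules and homomorphisms of degree `0`. -/
def Iso (M N : GrMod 𝒜) : Prop :=
  ∃ e : M ≃ₗ[A] N, ∀ i m, m ∈ M.gr i ↔ e m ∈ N.gr i

/-- The shift `M⟨d⟩`, with `M⟨d⟩_i = M_{i-d}`. -/
def shift (M : GrMod 𝒜) (d : ℤ) : GrMod 𝒜 where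
  carrier := M
  gr i := M.gr (i - d)
  internal := by
    refine isInternal_of_proj _ (fun i => M.proj (i - d))
      (fun i x hx => gradedProj_same M.internal hx)
      (fun i j hij x hx => gradedProj_ne M.internal (by omega) hx) ?_
    rw [← iSup_gr M.internal]
    exact (Equiv.subRight d).iSup_comp (g := M.gr)
  smul_mem {i j a m} ha hm := by
    have := M.smul_mem ha hm
    rwa [← add_sub_assoc] at this

/-- Graded (homogeneous) submodules. -/
def IsHomog (M : GrMod 𝒜) (N : Submodule A M) : Prop :=
  ∀ x ∈ N, ∀ i, M.proj i x ∈ N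

/-- A graded submodule as a graded module, with `N_i = N ∩ M_i`. -/
def sub (M : GrMod 𝒜) (N : Submodule A M) (hN : M.IsHomog N) : GrMod 𝒜 where
  carrier := N
  gr i := (M.gr i).comap (N.subtype.restrictScalars ℂ)
  internal := by
    let π : ℤ → N →ₗ[ℂ] N := fun i =>
      LinearMap.restrict (M.proj i) (p := N.restrictScalars ℂ) (q := N.restrictScalars ℂ)
        (fun x hx => hN x hx i)
    refine isInternal_of_proj _ π (fun i x hx => ?_) (fun i j hij x hx => ?_) ?_
    · exact Subtype.ext (gradedProj_same M.internal hx)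
    · exact Subtype.ext (gradedProj_ne M.internal hij hx)
    · refine eq_top_iff.2 fun x _ => ?_
      obtain ⟨s, hs⟩ := exists_finset_sum M.internal (x : M)
      have : x = ∑ i ∈ s, π i x := by
        apply Subtype.ext
        refine hs.trans ?_
        rw [AddSubmonoidClass.coe_finsetSum]
        rfl
      rw [this]
      exact Submodule.sum_mem _ fun i _ =>
        Submodule.mem_iSup_of_mem i (gradedProj_mem M.internal i (x : M))
  smul_mem ha hm := M.smul_mem ha hm

/-- The quotient by a graded submodule, graded by the images of the `M_i`. -/
def quot (M : GrMod 𝒜) (N : Submodule A M) (hN : M.IsHomog N) : GrMod 𝒜 where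
  carrier := M ⧸ N
  gr i := (M.gr i).map (N.mkQ.restrictScalars ℂ)
  internal := by
    let π : ℤ → (M ⧸ N) →ₗ[ℂ] (M ⧸ N) := fun i =>
      Submodule.mapQ (N.restrictScalars ℂ) (N.restrictScalars ℂ) (M.proj i)
        (fun x hx => hN x hx i)
    refine isInternal_of_proj _ π ?_ ?_ ?_
    · rintro i _ ⟨x, hx, rfl⟩
      exact congrArg N.mkQ (gradedProj_same M.internal hx)
    · rintro i j hij _ ⟨x, hx, rfl⟩
      exact (congrArg N.mkQ (gradedProj_ne M.internal hij hx)).trans (map_zero _)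
    · rw [← Submodule.map_iSup, iSup_gr M.internal, Submodule.map_top, LinearMap.range_eq_top]
      exact N.mkQ_surjective
  smul_mem := by
    rintro i j a _ ha ⟨x, hx, rfl⟩
    exact ⟨a • x, M.smul_mem ha hx, rfl⟩

theorem proj_hom {M N : GrMod 𝒜} {d : ℤ} {f : M →ₗ[A] N} (hf : f ∈ homDeg M N d) (i : ℤ)
    (x : M) : N.proj (i + d) (f x) = f (M.proj i x) := by
  have : x ∈ LinearMap.eqLocus ((N.proj (i + d)).comp (f.restrictScalars ℂ))
      ((f.restrictScalars ℂ).comp (M.proj i)) := by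
    have hle : (⊤ : Submodule ℂ M) ≤ LinearMap.eqLocus ((N.proj (i + d)).comp (f.restrictScalars ℂ))
      ((f.restrictScalars ℂ).comp (M.proj i)) := by
      rw [← iSup_gr M.internal]
      refine iSup_le fun j y hy => ?_
      have h1 := hf j y hy
      by_cases hij : j = i
      · subst hij
        exact (gradedProj_same N.internal h1).trans
          (congrArg f (gradedProj_same M.internal hy)).symm
      · exact (gradedProj_ne N.internal (by omega) h1).trans
          ((congrArg f (gradedProj_ne M.internal hij hy)).trans (map_zero f)).symm
    exact hle trivial
  exact this

theorem isHomog_range {M N : GrMod 𝒜} {d : ℤ} {f : M →ₗ[A] N} (hf : f ∈ homDeg M N d) :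
    N.IsHomog (LinearMap.range f) := by
  rintro _ ⟨x, rfl⟩ i
  have := proj_hom hf (i - d) x
  rw [sub_add_cancel] at this
  exact ⟨_, this.symm⟩

theorem isHomog_ker {M N : GrMod 𝒜} {d : ℤ} {f : M →ₗ[A] N} (hf : f ∈ homDeg M N d) :
    M.IsHomog (LinearMap.ker f) := by
  intro x hx i
  rw [LinearMap.mem_ker, ← proj_hom hf, LinearMap.mem_ker.1 hx, map_zero]

theorem isHomog_iSup {M : GrMod 𝒜} {ι : Sort*} (N : ι → Submodule A M)
    (hN : ∀ k, M.IsHomog (N k)) : M.IsHomog (⨆ k, N k) := by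
  intro x hx i
  induction hx using Submodule.iSup_induction' with
  | mem k y hy => exact Submodule.mem_iSup_of_mem k (hN k y hy i)
  | zero => rw [map_zero]; exact Submodule.zero_mem _
  | add y z _ _ h1 h2 => rw [map_add]; exact Submodule.add_mem _ h1 h2

theorem isHomog_submoduleOf {M : GrMod 𝒜} {N N' : Submodule A M} (hN : M.IsHomog N)
    (hN' : M.IsHomog N') : (M.sub N hN).IsHomog (N'.submoduleOf N) := by
  intro x hx i
  have hsub : N.subtype ∈ homDeg (M.sub N hN) M 0 := by
    intro j m hm
    rw [add_zero]
    exact hm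
  have h1 := proj_hom hsub i x
  rw [add_zero] at h1
  have h2 : M.proj i (N.subtype x) ∈ N' := hN' _ hx i
  exact Eq.mp (congrArg (fun y => y ∈ N') h1) h2

/-! ### Filtrations -/

/-- An `F`-filtration of `M`: a separable descending sequence of graded submodules starting at `M`
each of whose factors is zero or isomorphic to a shift of a member of the family `F`. -/
structure Filtration {ι : Type*} (F : ι → GrMod 𝒜) (M : GrMod 𝒜) where
  N : ℕ → Submodule A M
  homog : ∀ i, M.IsHomog (N i)
  top : N 0 = ⊤
  anti : ∀ i, N (i + 1) ≤ N i
  separable : ⨅ i, N i = ⊥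
  factor_cases : ∀ i,
    Subsingleton ((M.sub (N i) (homog i)).quot ((N (i + 1)).submoduleOf (N i))
      (isHomog_submoduleOf (homog i) (homog (i + 1)))) ∨
    ∃ (α : ι) (d : ℤ), ((M.sub (N i) (homog i)).quot ((N (i + 1)).submoduleOf (N i))
      (isHomog_submoduleOf (homog i) (homog (i + 1)))).Iso ((F α).shift d)

/-- The factor `M^i / M^{i+1}`. -/
def Filtration.factor {ι : Type*} {F : ι → GrMod 𝒜} {M : GrMod 𝒜} (Φ : Filtration F M) (i : ℕ) :
    GrMod 𝒜 :=
  (M.sub (Φ.N i) (Φ.homog i)).quot ((Φ.N (i + 1)).submoduleOf (Φ.N i))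
    (isHomog_submoduleOf (Φ.homog i) (Φ.homog (i + 1)))

/-- The number of factors of the filtration that are isomorphic to `F_α⟨d⟩`. -/
def Filtration.count {ι : Type*} {F : ι → GrMod 𝒜} {M : GrMod 𝒜} (Φ : Filtration F M)
    (α : ι) (d : ℤ) : ℕ∞ :=
  {i : ℕ | (Φ.factor i).Iso ((F α).shift d)}.encard

/-! ### Projective resolutions and `Ext` -/

/-- `P` is a projective object of the category of finitely generated graded modules. -/
def IsProjective (P : GrMod 𝒜) : Prop :=
  ∀ (X Y : GrMod 𝒜), X.FG → Y.FG → ∀ g ∈ homDeg X Y 0, Function.Surjective g →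
    ∀ h ∈ homDeg P Y 0, ∃ l ∈ homDeg P X 0, g ∘ₗ l = h

/-- A projective resolution `⋯ → P₂ → P₁ → P₀ → M → 0` in the category of finitely generated
graded modules. -/
structure ProjRes (M : GrMod 𝒜) where
  P : ℕ → GrMod 𝒜
  fg : ∀ i, (P i).FG
  projective : ∀ i, (P i).IsProjective
  d : ∀ i, P (i + 1) →ₗ[A] P i
  d_deg : ∀ i, d i ∈ homDeg (P (i + 1)) (P i) 0
  ε : P 0 →ₗ[A] M
  ε_deg : ε ∈ homDeg (P 0) M 0
  ε_surj : Function.Surjective ε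
  exact_zero : LinearMap.range (d 0) = LinearMap.ker ε
  exact_succ : ∀ i, LinearMap.range (d (i + 1)) = LinearMap.ker (d i)

/-- The cocycles in `Hom_A(P_i, N)_n`. -/
def ProjRes.cocycles {M : GrMod 𝒜} (R : ProjRes M) (N : GrMod 𝒜) (i : ℕ) (n : ℤ) :
    Submodule ℂ (R.P i →ₗ[A] N) :=
  homDeg (R.P i) N n ⊓ LinearMap.ker (LinearMap.lcomp ℂ N (R.d i))

/-- The coboundaries in `Hom_A(P_i, N)_n`. -/
def ProjRes.coboundaries {M : GrMod 𝒜} (R : ProjRes M) (N : GrMod 𝒜) (n : ℤ) :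
    (i : ℕ) → Submodule ℂ (R.P i →ₗ[A] N)
  | 0 => ⊥
  | i + 1 => (homDeg (R.P i) N n).map (LinearMap.lcomp ℂ N (R.d i))

/-- The graded free module `⨁_j A⟨deg j⟩`. -/
def free [GradedAlgebra 𝒜] {k : ℕ} (deg : Fin k → ℤ) : GrMod 𝒜 where
  carrier := Fin k → A
  gr i := Submodule.pi Set.univ fun j => 𝒜 (i - deg j)
  internal := by
    have hA : DirectSum.IsInternal 𝒜 := DirectSum.Decomposition.isInternal 𝒜
    refine isInternal_of_proj _
      (fun i => LinearMap.pi fun j => gradedProj 𝒜 hA (i - deg j) ∘ₗ LinearMap.proj j) ?_ ?_ ?_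
    · intro i x hx
      funext j
      exact gradedProj_same hA (hx j trivial)
    · intro i i' hi x hx
      funext j
      exact gradedProj_ne hA (by omega) (hx j trivial)
    · refine eq_top_iff.2 fun x _ => ?_
      rw [← Finset.univ_sum_single x]
      refine Submodule.sum_mem _ fun j _ => ?_
      obtain ⟨s, hs⟩ := exists_finset_sum hA (x j)
      have hx : (Pi.single j (x j) : Fin k → A) =
          ∑ e ∈ s, Pi.single j (gradedProj 𝒜 hA e (x j)) := by
        conv_lhs => rw [hs]
        exact map_sum (LinearMap.single ℂ (fun _ : Fin k => A) j) _ _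
      rw [hx]
      refine Submodule.sum_mem _ fun e _ => Submodule.mem_iSup_of_mem (e + deg j) ?_
      intro j' _
      by_cases hj : j' = j
      · subst hj
        simpa using gradedProj_mem hA e (x j')
      · simp [hj]
  smul_mem {i j a m} ha hm := by
    intro l _
    have := SetLike.GradedMul.mul_mem ha (hm l trivial)
    rwa [← add_sub_assoc] at this

/-- The map from a free graded module given by elements of a graded module. -/
def freeLift [GradedAlgebra 𝒜] {k : ℕ} (deg : Fin k → ℤ) (X : GrMod 𝒜) (x : Fin k → X) :
    free (𝒜 := 𝒜) deg →ₗ[A] X :=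
  Fintype.linearCombination A x

theorem freeLift_deg [GradedAlgebra 𝒜] {k : ℕ} (deg : Fin k → ℤ) (X : GrMod 𝒜) (x : Fin k → X)
    (hx : ∀ j, x j ∈ X.gr (deg j)) : freeLift deg X x ∈ homDeg (free deg) X 0 := by
  intro i v hv
  have h1 : freeLift deg X x v = ∑ j, (v : Fin k → A) j • x j :=
    Fintype.linearCombination_apply A x v
  rw [h1, add_zero]
  refine Submodule.sum_mem _ fun j _ => ?_
  have := X.smul_mem (hv j trivial) (hx j)
  rwa [sub_add_cancel] at this

theorem free_fg [GradedAlgebra 𝒜] {k : ℕ} (deg : Fin k → ℤ) : (free (𝒜 := 𝒜) deg).FG :=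
  inferInstanceAs (Module.Finite A (Fin k → A))

theorem free_projective [GradedAlgebra 𝒜] {k : ℕ} (deg : Fin k → ℤ) :
    (free (𝒜 := 𝒜) deg).IsProjective := by
  intro X Y _ _ g hg hsurj h hh
  have key : ∀ j, ∃ x ∈ X.gr (deg j), g x = h (Pi.single j (1 : A)) := by
    intro j
    obtain ⟨x, hx⟩ := hsurj (h (Pi.single j (1 : A)))
    refine ⟨X.proj (deg j) x, gradedProj_mem _ _ _, ?_⟩
    rw [← proj_hom hg, hx]
    have h1 : (Pi.single j (1 : A) : Fin k → A) ∈ (free (𝒜 := 𝒜) deg).gr (deg j) := by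
      intro j' _
      by_cases hj : j' = j
      · subst hj
        simpa using SetLike.GradedOne.one_mem (A := 𝒜)
      · simp [hj]
    exact gradedProj_same _ (hh _ _ h1)
  choose x hx hgx using key
  refine ⟨freeLift deg X x, freeLift_deg deg X x hx, ?_⟩
  refine LinearMap.pi_ext' fun j => LinearMap.ext_ring ?_
  change g (freeLift deg X x (Pi.single j (1 : A))) = h (Pi.single j (1 : A))
  have h1 : freeLift deg X x (Pi.single j (1 : A)) = (1 : A) • x j :=
    Fintype.linearCombination_apply_single A x j 1
  rw [← hgx j, h1, one_smul]

theorem exists_cover [GradedAlgebra 𝒜] (M : GrMod 𝒜) (hM : M.FG) :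
    ∃ (k : ℕ) (deg : Fin k → ℤ), ∃ f ∈ homDeg (free deg) M 0, Function.Surjective f := by
  classical
  obtain ⟨s, hs⟩ := Module.finite_def.1 hM
  choose t ht using fun x : M => exists_finset_sum M.internal x
  let T : Finset (Σ _ : M, ℤ) := s.sigma t
  let e := T.equivFin.symm
  refine ⟨T.card, fun j => (e j).1.2,
    freeLift _ M (fun j => M.proj (e j).1.2 (e j).1.1), freeLift_deg _ _ _
      (fun j => gradedProj_mem _ _ _), ?_⟩
  rw [← LinearMap.range_eq_top]
  change LinearMap.range (Fintype.linearCombination A _) = ⊤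
  rw [Fintype.range_linearCombination, eq_top_iff, ← hs, Submodule.span_le]
  intro x hx
  rw [SetLike.mem_coe, ht x]
  refine Submodule.sum_mem _ fun i hi => Submodule.subset_span ?_
  refine ⟨T.equivFin ⟨⟨x, i⟩, Finset.mem_sigma.2 ⟨hx, hi⟩⟩, ?_⟩
  simp [e, proj]

section Resolution

variable [GradedAlgebra 𝒜] [IsNoetherianRing A]

theorem exists_syzygy (M : {M : GrMod 𝒜 // M.FG}) :
    ∃ (P : GrMod 𝒜) (Z : {M : GrMod 𝒜 // M.FG}) (f : P →ₗ[A] M.1) (g : Z.1 →ₗ[A] P),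
      P.FG ∧ P.IsProjective ∧ f ∈ homDeg P M.1 0 ∧ g ∈ homDeg Z.1 P 0 ∧
      Function.Surjective f ∧ Function.Injective g ∧ LinearMap.range g = LinearMap.ker f := by
  obtain ⟨k, deg, f, hf, hs⟩ := exists_cover M.1 M.2
  have : Module.Finite A (free (𝒜 := 𝒜) deg) := free_fg deg
  have : IsNoetherian A (free (𝒜 := 𝒜) deg) := isNoetherian_of_isNoetherianRing_of_finite A _
  refine ⟨free deg, ⟨(free deg).sub (LinearMap.ker f) (isHomog_ker hf), ?_⟩, f,
    (LinearMap.ker f).subtype, free_fg deg, free_projective deg, hf, ?_, hs,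
    Subtype.val_injective, Submodule.range_subtype _⟩
  · exact inferInstanceAs (Module.Finite A (LinearMap.ker f))
  · intro i m hm
    rw [add_zero]
    exact hm

/-- Every finitely generated graded module over a Noetherian graded algebra has a projective
resolution. -/
theorem nonempty_projRes (M : GrMod 𝒜) (hM : M.FG) : Nonempty (ProjRes M) := by
  choose P Z f g hfg hproj hf hg hfs hgi hex using exists_syzygy (𝒜 := 𝒜)
  let S : ℕ → {M : GrMod 𝒜 // M.FG} := fun i => Nat.rec ⟨M, hM⟩ (fun _ X => Z X) i
  refine ⟨⟨fun i => P (S i), fun i => hfg _, fun i => hproj _,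
    fun i => g (S i) ∘ₗ f (S (i + 1)), ?_, f (S 0), hf _, hfs _, ?_, ?_⟩⟩
  · intro i j m hm
    have h1 := hg _ _ _ (hf (S (i + 1)) j m hm)
    rwa [add_zero] at h1
  · rw [LinearMap.range_comp, LinearMap.range_eq_top.2 (hfs _), Submodule.map_top]
    exact hex _
  · intro i
    rw [LinearMap.range_comp, LinearMap.range_eq_top.2 (hfs _), Submodule.map_top,
      LinearMap.ker_comp_of_ker_eq_bot _ (LinearMap.ker_eq_bot.2 (hgi _))]
    exact hex _

/-- A projective resolution of a finitely generated graded module. -/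
def projRes (M : GrMod 𝒜) (hM : M.FG) : ProjRes M := (nonempty_projRes M hM).some

/-- `Ext M hM N i n` is `Ext^i_A(M, N)_n`, the degree `n` part of the `i`-th extension group: the
`i`-th cohomology of the complex `Hom_A(P_•, N)_n` for a projective resolution `P_•` of `M` in the
category of finitely generated graded modules. -/
abbrev Ext (M : GrMod 𝒜) (hM : M.FG) (N : GrMod 𝒜) (i : ℕ) (n : ℤ) : Type u :=
  (M.projRes hM).cocycles N i n ⧸
    ((M.projRes hM).coboundaries N n i).submoduleOf ((M.projRes hM).cocycles N i n)

end Resolution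

end GrMod

end GradedModules

/-! ## Skew group algebras -/

section SkewGroupAlgebra

open TensorProduct

/-- The polynomial ring `S = ℂ[X_1, …, X_n]`. -/
abbrev PolyRing (n : ℕ) : Type := MvPolynomial (Fin n) ℂ

/-- The degree `i` part of `S` (each variable has degree `1`). -/
abbrev polyGr (n : ℕ) (i : ℤ) : Submodule ℂ (PolyRing n) :=
  MvPolynomial.weightedHomogeneousSubmodule ℂ (fun _ : Fin n => (1 : ℤ)) i

theorem polyGr_internal (n : ℕ) : DirectSum.IsInternal (polyGr n) :=
  letI := MvPolynomial.weightedGradedAlgebra ℂ (fun _ : Fin n => (1 : ℤ))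
  DirectSum.Decomposition.isInternal (polyGr n)

theorem polyGr_mul_mem {n : ℕ} {i j : ℤ} {p q : PolyRing n} (hp : p ∈ polyGr n i)
    (hq : q ∈ polyGr n j) : p * q ∈ polyGr n (i + j) :=
  MvPolynomial.IsWeightedHomogeneous.mul hp hq

/-- The action of `W` on `S` preserves the grading. -/
class IsGradedAction (n : ℕ) (W : Type u) [Group W] [MulSemiringAction W (PolyRing n)] : Prop where
  smul_mem : ∀ (w : W) (i : ℤ), ∀ p ∈ polyGr n i, w • p ∈ polyGr n i

/-- The skew group algebra `S * W`, in which `SkewMonoidAlgebra.single w s` is `s ⊗ w` and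
`(s ⊗ w)(s' ⊗ w') = s w(s') ⊗ w w'`. -/
abbrev SkewAlg (n : ℕ) (W : Type u) : Type u := SkewMonoidAlgebra (PolyRing n) W

variable (n : ℕ) (W : Type u) [Group W] [MulSemiringAction W (PolyRing n)]
  [SMulCommClass W ℂ (PolyRing n)]

instance : SMulCommClass ℂ W (PolyRing n) := SMulCommClass.symm _ _ _

/-- The degree `i` part `S_i ⊗ ℂW` of `S * W`. -/
def skewGr (i : ℤ) : Submodule ℂ (SkewAlg n W) where
  carrier := {a | ∀ w, a.coeff w ∈ polyGr n i}
  add_mem' {a b} ha hb w := by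
    rw [SkewMonoidAlgebra.coeff_add]
    exact (polyGr n i).add_mem (ha w) (hb w)
  zero_mem' w := (polyGr n i).zero_mem
  smul_mem' c a ha w := by
    rw [SkewMonoidAlgebra.coeff_smul]
    exact (polyGr n i).smul_mem c (ha w)

variable {n W}

theorem single_mem_skewGr {i : ℤ} {p : PolyRing n} (hp : p ∈ polyGr n i) (w : W) :
    SkewMonoidAlgebra.single w p ∈ skewGr n W i := by
  classical
  intro w'
  rw [SkewMonoidAlgebra.coeff_single_apply]
  split_ifs
  · exact hp
  · exact (polyGr n i).zero_mem

theorem skewGr_internal : DirectSum.IsInternal (skewGr n W) := by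
  let π : ℤ → SkewAlg n W →ₗ[ℂ] SkewAlg n W := fun i =>
    { toFun := fun a =>
        ⟨Finsupp.mapRange.linearMap (gradedProj (polyGr n) (polyGr_internal n) i) a.coeff⟩
      map_add' := fun a b => by
        rw [SkewMonoidAlgebra.coeff_add, map_add]; exact SkewMonoidAlgebra.ofCoeff_add
      map_smul' := fun c a => by
        rw [SkewMonoidAlgebra.coeff_smul, map_smul]
        exact SkewMonoidAlgebra.ofCoeff_smul _ _ }
  have hπ : ∀ i a w, (π i a).coeff w = gradedProj (polyGr n) (polyGr_internal n) i (a.coeff w) :=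
    fun i a w => rfl
  refine isInternal_of_proj _ π ?_ ?_ ?_
  · intro i x hx
    ext1 w
    rw [hπ]
    exact gradedProj_same _ (hx w)
  · intro i j hij x hx
    ext1 w
    rw [hπ]
    exact gradedProj_ne _ hij (hx w)
  · refine eq_top_iff.2 fun x _ => ?_
    induction x using SkewMonoidAlgebra.induction_on with
    | zero => exact Submodule.zero_mem _
    | add a b ha hb => exact Submodule.add_mem _ (ha trivial) (hb trivial)
    | single w p =>
      have hp : p ∈ ⨆ i, polyGr n i := by rw [iSup_gr (polyGr_internal n)]; trivial
      clear * - hp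
      induction hp using Submodule.iSup_induction' with
      | mem i p hp => exact Submodule.mem_iSup_of_mem i (single_mem_skewGr hp w)
      | zero => rw [SkewMonoidAlgebra.single_zero]; exact Submodule.zero_mem _
      | add p q _ _ hp hq => rw [SkewMonoidAlgebra.single_add]; exact Submodule.add_mem _ hp hq

variable (n W) in
/-- `S * W` is a graded algebra. -/
instance skewGradedAlgebra [IsGradedAction n W] : GradedAlgebra (skewGr n W) where
  one_mem := single_mem_skewGr (MvPolynomial.isWeightedHomogeneous_one ℂ _) 1
  mul_mem i j a b ha hb := by
    rw [SkewMonoidAlgebra.mul_def]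
    refine Submodule.sum_mem _ fun w _ => Submodule.sum_mem _ fun w' _ => ?_
    exact single_mem_skewGr (polyGr_mul_mem (ha w) (IsGradedAction.smul_mem w j _ (hb w'))) _
  __ := skewGr_internal.chooseDecomposition

instance [Finite W] : IsNoetherianRing (SkewAlg n W) := by
  have : Module.Finite (PolyRing n) (SkewAlg n W) :=
    Module.Finite.of_basis SkewMonoidAlgebra.basisSingleOne
  have : IsNoetherian (PolyRing n) (SkewAlg n W) := isNoetherian_of_isNoetherianRing_of_finite _ _
  exact isNoetherian_of_tower (PolyRing n) this

/-- The graded `(S * W)`-module in which `s ⊗ w` acts as `f s ∘ g w`. -/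
def GrMod.ofSkew (M : Type u) [AddCommGroup M] [Module ℂ M] (gr : ℤ → Submodule ℂ M)
    (internal : DirectSum.IsInternal gr) (f : PolyRing n →ₐ[ℂ] Module.End ℂ M)
    (g : W →* Module.End ℂ M) (comm : ∀ (s : PolyRing n) (w : W), f (w • s) * g w = g w * f s)
    (hf : ∀ i j, ∀ s ∈ polyGr n i, ∀ m ∈ gr j, f s m ∈ gr (i + j))
    (hg : ∀ w j, ∀ m ∈ gr j, g w m ∈ gr j) : GrMod (skewGr n W) :=
  let φ : SkewAlg n W →+* Module.End ℂ M :=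
    SkewMonoidAlgebra.liftNCRingHom (f : PolyRing n →+* Module.End ℂ M) g
      (fun {s w} => comm s w)
  letI : Module (SkewAlg n W) M := Module.compHom M φ
  { carrier := M
    tower := ⟨fun c a m => by
      change φ (c • a) m = c • φ a m
      have h1 : c • a = (MvPolynomial.C c : PolyRing n) • a := by
        ext1 w
        rw [SkewMonoidAlgebra.coeff_smul, SkewMonoidAlgebra.coeff_smul]
        simp [MvPolynomial.smul_eq_C_mul]
      have h2 : φ ((MvPolynomial.C c : PolyRing n) • a) = f (MvPolynomial.C c) * φ a :=
        SkewMonoidAlgebra.liftNC_smul _ _ _ _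
      have h3 : f (MvPolynomial.C c) = algebraMap ℂ _ c := f.commutes c
      rw [h1, h2, h3]
      rfl⟩
    gr := gr
    internal := internal
    smul_mem := fun {i j a m} ha hm => by
      change φ a m ∈ gr (i + j)
      have h1 : φ a = a.sum fun w s => f s * g w := by
        conv_lhs => rw [← SkewMonoidAlgebra.sum_single a]
        rw [SkewMonoidAlgebra.map_sum]
        exact SkewMonoidAlgebra.sum_congr fun w _ => SkewMonoidAlgebra.liftNC_single _ _ _ _
      rw [h1, SkewMonoidAlgebra.sum_def, Finsupp.sum, LinearMap.sum_apply]
      exact Submodule.sum_mem _ fun w _ => hf i j _ (ha w) _ (hg w j m hm) }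

/-! ### Representations of `W` -/

variable (W) in
/-- A finite-dimensional irreducible complex representation of `W`. -/
structure IrrRep : Type (u + 1) where
  V : Type u
  [grp : AddCommGroup V]
  [mod : Module ℂ V]
  [fin : FiniteDimensional ℂ V]
  ρ : Representation ℂ W V
  irr : ρ.IsIrreducible

attribute [instance] IrrRep.grp IrrRep.mod IrrRep.fin

variable (W) in
/-- Isomorphism of irreducible representations. -/
def irrSetoid : Setoid (IrrRep W) where
  r X Y := Nonempty (X.ρ.Equiv Y.ρ)
  iseqv :=
    { refl := fun X => ⟨Representation.Equiv.refl X.ρ⟩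
      symm := fun ⟨e⟩ => ⟨e.symm⟩
      trans := fun ⟨e⟩ ⟨e'⟩ => ⟨e.trans e'⟩ }

variable (W) in
/-- The set `Irr(W)` of isomorphism classes of irreducible representations. -/
def Irr : Type (u + 1) := Quotient (irrSetoid W)

/-- A representative of an isomorphism class. -/
def Irr.rep (l : Irr W) : IrrRep W := Quotient.out (s := irrSetoid W) l

/-- The multiplicity `[V : λ]`: the number of simple summands of the `λ`-isotypic part of `V`. -/
def repMult {V : Type u} [AddCommGroup V] [Module ℂ V] (σ : Representation ℂ W V) (l : Irr W) :
    ℕ∞ :=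
  Module.length (MonoidAlgebra ℂ W)
    (isotypicComponent (MonoidAlgebra ℂ W) σ.asModule l.rep.ρ.asModule)

namespace GrMod

/-- The representation of `W` on `M_i`, through `w ↦ 1 ⊗ w`. -/
def compRep (M : GrMod (skewGr n W)) (i : ℤ) : Representation ℂ W (M.gr i) where
  toFun w :=
    { toFun := fun m => ⟨(SkewMonoidAlgebra.single w (1 : PolyRing n)) • (m : M), by
        have := M.smul_mem (single_mem_skewGr (n := n)
          (MvPolynomial.isWeightedHomogeneous_one ℂ (fun _ : Fin n => (1 : ℤ))) w) m.2
        rwa [zero_add] at this⟩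
      map_add' := fun a b => Subtype.ext (smul_add _ _ _)
      map_smul' := fun c a => Subtype.ext (smul_comm _ c (a : M)) }
  map_one' := by
    ext m
    exact one_smul (SkewAlg n W) (m : M)
  map_mul' w w' := by
    ext m
    have : (SkewMonoidAlgebra.single (w * w') (1 : PolyRing n)) =
      SkewMonoidAlgebra.single w (1 : PolyRing n) * SkewMonoidAlgebra.single w' 1 := by
      rw [SkewMonoidAlgebra.single_mul_single, smul_one, mul_one]
    change (SkewMonoidAlgebra.single (w * w') (1 : PolyRing n)) • (m : M) = _
    rw [this, mul_smul]
    rfl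

/-- The coefficient of `q^i` in `[M : L_λ]_q`, that is, the multiplicity `[M_i : λ]`. -/
def mult (M : GrMod (skewGr n W)) (l : Irr W) (i : ℤ) : ℕ∞ := repMult (M.compRep i) l

/-! ### The modules `P_λ`, the dual, and the trace quotients -/

variable [IsGradedAction n W]

variable (n) in
/-- The graded `(S * W)`-module `P_λ = S ⊗ λ`, with `(s ⊗ w)(p ⊗ v) = s w(p) ⊗ w v` and
`(P_λ)_i = S_i ⊗ λ`. -/
def P (l : Irr W) : GrMod (skewGr n W) :=
  ofSkew (TensorProduct ℂ (PolyRing n) l.rep.V)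
    (fun i => LinearMap.range (LinearMap.rTensor l.rep.V (polyGr n i).subtype))
    (by
      refine isInternal_of_proj _ (fun i => LinearMap.rTensor l.rep.V
        (gradedProj (polyGr n) (polyGr_internal n) i)) ?_ ?_ ?_
      · rintro i _ ⟨x, rfl⟩
        rw [← LinearMap.comp_apply, ← LinearMap.rTensor_comp]
        congr 2
        ext1 y
        exact gradedProj_same _ y.2
      · rintro i j hij _ ⟨x, rfl⟩
        rw [← LinearMap.comp_apply, ← LinearMap.rTensor_comp]
        have : gradedProj (polyGr n) (polyGr_internal n) j ∘ₗ (polyGr n i).subtype = 0 := by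
          ext1 y
          exact gradedProj_ne _ hij y.2
        rw [this, LinearMap.rTensor_zero, LinearMap.zero_apply]
      · refine eq_top_iff.2 fun x _ => ?_
        induction x with
        | zero => exact Submodule.zero_mem _
        | add a b ha hb => exact Submodule.add_mem _ (ha trivial) (hb trivial)
        | tmul p v =>
          have hp : p ∈ ⨆ i, polyGr n i := by rw [iSup_gr (polyGr_internal n)]; trivial
          clear * - hp
          induction hp using Submodule.iSup_induction' with
          | mem i p hp =>
            exact Submodule.mem_iSup_of_mem i ⟨(⟨p, hp⟩ : polyGr n i) ⊗ₜ[ℂ] v, rfl⟩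
          | zero => rw [TensorProduct.zero_tmul]; exact Submodule.zero_mem _
          | add p q _ _ hp hq => rw [TensorProduct.add_tmul]; exact Submodule.add_mem _ hp hq)
    (Algebra.lsmul ℂ ℂ (TensorProduct ℂ (PolyRing n) l.rep.V))
    ((Representation.ofDistribMulAction ℂ W (PolyRing n)).tprod l.rep.ρ)
    (by
      intro s w
      refine TensorProduct.ext' fun p v => ?_
      change ((w • s) * (w • p)) ⊗ₜ[ℂ] (l.rep.ρ w v) = (w • (s * p)) ⊗ₜ[ℂ] (l.rep.ρ w v)
      rw [smul_mul'])
    (by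
      rintro i j s hs _ ⟨x, rfl⟩
      induction x with
      | zero => simp
      | add a b ha hb => rw [map_add, map_add]; exact Submodule.add_mem _ ha hb
      | tmul p v => exact ⟨(⟨s * p, polyGr_mul_mem hs p.2⟩ : polyGr n (i + j)) ⊗ₜ[ℂ] v, rfl⟩)
    (by
      rintro w j _ ⟨x, rfl⟩
      induction x with
      | zero => simp
      | add a b ha hb => rw [map_add, map_add]; exact Submodule.add_mem _ ha hb
      | tmul p v =>
        exact ⟨(⟨w • (p : PolyRing n), IsGradedAction.smul_mem w j _ p.2⟩ : polyGr n j) ⊗ₜ[ℂ]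
          l.rep.ρ w v, rfl⟩)

theorem P_fg (l : Irr W) : (P n l).FG := by
  let _ : SMulZeroClass (PolyRing n) (P n l) :=
    inferInstanceAs (SMulZeroClass (PolyRing n) (PolyRing n ⊗[ℂ] l.rep.V))
  let _ : Module (PolyRing n) (P n l) :=
    inferInstanceAs (Module (PolyRing n) (PolyRing n ⊗[ℂ] l.rep.V))
  have : IsScalarTower (PolyRing n) (SkewAlg n W) (P n l) := by
    refine ⟨fun s a m => ?_⟩
    exact congrArg (fun φ : Module.End ℂ (PolyRing n ⊗[ℂ] l.rep.V) => φ m)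
      (SkewMonoidAlgebra.liftNC_smul
        ((Algebra.lsmul ℂ ℂ (PolyRing n ⊗[ℂ] l.rep.V) :
          PolyRing n →ₐ[ℂ] Module.End ℂ (PolyRing n ⊗[ℂ] l.rep.V)) :
          PolyRing n →+* Module.End ℂ (PolyRing n ⊗[ℂ] l.rep.V))
        ((Representation.ofDistribMulAction ℂ W (PolyRing n)).tprod l.rep.ρ) s a)
  have : Module.Finite (PolyRing n) (P n l) :=
    inferInstanceAs (Module.Finite (PolyRing n) (PolyRing n ⊗[ℂ] l.rep.V))
  exact Module.Finite.of_restrictScalars_finite (PolyRing n) (SkewAlg n W) (P n l)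

/-- The functionals on `M` that vanish on all but finitely many `M_j`, that is
`⨁_i Hom_ℂ(M_{-i}, ℂ)`; these are all functionals when `M` is finite-dimensional. -/
def dualCarrier (M : GrMod (skewGr n W)) : Submodule ℂ (Module.Dual ℂ M) where
  carrier := {f | ∃ s : Finset ℤ, ∀ j ∉ s, ∀ m ∈ M.gr j, f m = 0}
  add_mem' := by
    classical
    rintro f g ⟨s, hs⟩ ⟨t, ht⟩
    refine ⟨s ∪ t, fun j hj m hm => ?_⟩
    rw [Finset.mem_union, not_or] at hj
    rw [LinearMap.add_apply, hs j hj.1 m hm, ht j hj.2 m hm, add_zero]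
  zero_mem' := ⟨∅, fun _ _ _ _ => rfl⟩
  smul_mem' := by
    rintro c f ⟨s, hs⟩
    exact ⟨s, fun j hj m hm => by rw [LinearMap.smul_apply, hs j hj m hm, smul_zero]⟩

theorem comp_mem_dualCarrier (M : GrMod (skewGr n W)) (a : SkewAlg n W) {f : Module.Dual ℂ M}
    (hf : f ∈ dualCarrier M) : f ∘ₗ Algebra.lsmul ℂ ℂ M a ∈ dualCarrier M := by
  have ha : a ∈ ⨆ i, skewGr n W i := by rw [iSup_gr skewGr_internal]; trivial
  induction ha using Submodule.iSup_induction' with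
  | mem i a ha =>
    obtain ⟨s, hs⟩ := hf
    classical
    refine ⟨s.image (fun j => j - i), fun j hj m hm => hs (i + j) (fun h => hj ?_) _
      (M.smul_mem ha hm)⟩
    exact Finset.mem_image.2 ⟨i + j, h, by omega⟩
  | zero => rw [map_zero, LinearMap.comp_zero]; exact Submodule.zero_mem _
  | add a b _ _ ha hb => rw [map_add, LinearMap.comp_add]; exact Submodule.add_mem _ ha hb

/-- The right action of `a` on functionals: `f ↦ f(a ·)`. -/
def dualPrecomp (M : GrMod (skewGr n W)) (a : SkewAlg n W) : Module.End ℂ (dualCarrier M) where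
  toFun f := ⟨f.1 ∘ₗ Algebra.lsmul ℂ ℂ M a, comp_mem_dualCarrier M a f.2⟩
  map_add' _ _ := rfl
  map_smul' _ _ := rfl

theorem dualPrecomp_mul (M : GrMod (skewGr n W)) (a b : SkewAlg n W) :
    dualPrecomp M a * dualPrecomp M b = dualPrecomp M (b * a) := by
  refine LinearMap.ext fun f => Subtype.ext (LinearMap.ext fun m => ?_)
  exact congrArg f.1 (mul_smul b a m).symm

theorem dualPrecomp_one (M : GrMod (skewGr n W)) : dualPrecomp M 1 = 1 := by
  refine LinearMap.ext fun f => Subtype.ext (LinearMap.ext fun m => ?_)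
  exact congrArg f.1 (one_smul (SkewAlg n W) m)

/-- The dual `M^*`, with `((s ⊗ w) f)(m) = f((w⁻¹(s) ⊗ w⁻¹) m)` and
`(M^*)_i = Hom_ℂ(M_{-i}, ℂ)`: here `s` acts by `f ↦ f(s ·)` and `w` by `f ↦ f(w⁻¹ ·)`. -/
def dual (M : GrMod (skewGr n W)) : GrMod (skewGr n W) :=
  ofSkew (dualCarrier M)
    (fun i =>
      { carrier := {f | ∀ j, j ≠ -i → ∀ m ∈ M.gr j, f.1 m = 0}
        add_mem' := fun {f g} hf hg j hj m hm => by
          change f.1 m + g.1 m = 0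
          rw [hf j hj m hm, hg j hj m hm, add_zero]
        zero_mem' := fun _ _ _ _ => rfl
        smul_mem' := fun c f hf j hj m hm => by
          change c • f.1 m = 0
          rw [hf j hj m hm, smul_zero] })
    (by
      have hext : ∀ f g : Module.Dual ℂ M, (∀ j, ∀ m ∈ M.gr j, f m = g m) → f = g := by
        intro f g h
        have : (⊤ : Submodule ℂ M) ≤ LinearMap.eqLocus f g := by
          rw [← iSup_gr M.internal]
          exact iSup_le fun j m hm => h j m hm
        exact LinearMap.ext fun m => this trivial
      have hcomp : ∀ (i : ℤ) (f : Module.Dual ℂ M), ∀ j, j ≠ i → ∀ m ∈ M.gr j,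
          (f ∘ₗ M.proj i) m = 0 := by
        intro i f j hj m hm
        rw [LinearMap.comp_apply, GrMod.proj, gradedProj_ne _ hj hm, map_zero]
      have hsame : ∀ (i : ℤ) (f : Module.Dual ℂ M), ∀ m ∈ M.gr i,
          (f ∘ₗ M.proj i) m = f m := by
        intro i f m hm
        rw [LinearMap.comp_apply, GrMod.proj, gradedProj_same _ hm]
      let π : ℤ → Module.End ℂ (dualCarrier M) := fun i =>
        { toFun := fun f => ⟨f.1 ∘ₗ M.proj (-i), {-i}, fun j hj m hm =>
            hcomp _ _ j (by simpa using hj) m hm⟩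
          map_add' := fun f g => rfl
          map_smul' := fun c f => rfl }
      refine isInternal_of_proj _ π ?_ ?_ ?_
      · intro i f hf
        refine Subtype.ext (hext _ _ fun j m hm => ?_)
        by_cases hj : j = -i
        · subst hj
          exact hsame _ _ m hm
        · exact (hcomp _ _ j hj m hm).trans (hf j hj m hm).symm
      · intro i k hik f hf
        refine Subtype.ext (hext _ _ fun j m hm => ?_)
        by_cases hj : j = -k
        · subst hj
          exact (hsame _ _ m hm).trans (hf _ (by omega) m hm)
        · exact hcomp _ _ j hj m hm
      · refine eq_top_iff.2 fun f _ => ?_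
        obtain ⟨s, hs⟩ := f.2
        have : f = ∑ j ∈ s, π (-j) f := by
          refine Subtype.ext (hext _ _ fun k m hm => ?_)
          have h1 : (∑ j ∈ s, π (-j) f).1 m = ∑ j ∈ s, f.1 (M.proj j m) := by
            rw [AddSubmonoidClass.coe_finsetSum, LinearMap.sum_apply]
            refine Finset.sum_congr rfl fun j _ => ?_
            change f.1 (M.proj (- -j) m) = _
            rw [neg_neg]
          rw [h1]
          by_cases hk : k ∈ s
          · rw [Finset.sum_eq_single_of_mem k hk]
            · exact (hsame k f.1 m hm).symm
            · exact fun j _ hj => hcomp j f.1 k hj.symm m hm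
          · rw [hs k hk m hm, Finset.sum_eq_zero]
            exact fun j hj => hcomp j f.1 k (fun h => hk (h ▸ hj)) m hm
        rw [this]
        refine Submodule.sum_mem _ fun j _ => Submodule.mem_iSup_of_mem (-j) ?_
        intro k hk m hm
        exact hcomp _ _ k hk m hm)
    { toFun := fun s => dualPrecomp M (SkewMonoidAlgebra.single 1 s)
      map_one' := dualPrecomp_one M
      map_mul' := fun s t => by
        rw [dualPrecomp_mul, SkewMonoidAlgebra.single_mul_single, one_smul, mul_one, mul_comm]
      map_zero' := by
        refine LinearMap.ext fun f => Subtype.ext (LinearMap.ext fun m => ?_)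
        change f.1 (SkewMonoidAlgebra.single (1 : W) (0 : PolyRing n) • m) = 0
        have h : SkewMonoidAlgebra.single (1 : W) (0 : PolyRing n) = (0 : SkewAlg n W) :=
          SkewMonoidAlgebra.single_zero _
        have h' : (SkewMonoidAlgebra.single (1 : W) (0 : PolyRing n) : SkewAlg n W) • m = 0 := by
          rw [h]; exact zero_smul (SkewAlg n W) m
        exact (congrArg f.1 h').trans (map_zero _)
      map_add' := fun s t => by
        refine LinearMap.ext fun f => Subtype.ext (LinearMap.ext fun m => ?_)
        change f.1 (SkewMonoidAlgebra.single (1 : W) (s + t) • m) =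
          f.1 (SkewMonoidAlgebra.single (1 : W) s • m) + f.1 (SkewMonoidAlgebra.single (1 : W) t • m)
        rw [SkewMonoidAlgebra.single_add, add_smul, map_add]
      commutes' := fun c => by
        refine LinearMap.ext fun f => Subtype.ext (LinearMap.ext fun m => ?_)
        change f.1 (algebraMap ℂ (SkewAlg n W) c • m) = c • f.1 m
        rw [algebraMap_smul, map_smul] }
    { toFun := fun w => dualPrecomp M (SkewMonoidAlgebra.single w⁻¹ 1)
      map_one' := by rw [inv_one]; exact dualPrecomp_one M
      map_mul' := fun w w' => by
        rw [dualPrecomp_mul, SkewMonoidAlgebra.single_mul_single, smul_one, mul_one, mul_inv_rev] }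
    (fun s w => by
      change dualPrecomp M _ * dualPrecomp M _ = dualPrecomp M _ * dualPrecomp M _
      rw [dualPrecomp_mul, dualPrecomp_mul, SkewMonoidAlgebra.single_mul_single,
        SkewMonoidAlgebra.single_mul_single, inv_smul_smul, one_smul, mul_one, one_mul, mul_one,
        one_mul])
    (fun i j s hs f hf k hk m hm =>
      hf (i + k) (by omega) _ (M.smul_mem (single_mem_skewGr hs 1) hm))
    (fun w j f hf k hk m hm => by
      have h1 := M.smul_mem (single_mem_skewGr (n := n)
        (MvPolynomial.isWeightedHomogeneous_one ℂ (fun _ : Fin n => (1 : ℤ))) w⁻¹) hm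
      rw [zero_add] at h1
      exact hf k hk _ h1)

section Trace

variable [Preorder (Irr W)]

variable (n) in
/-- `I_λ`: the sum of the images of the homogeneous `f ∈ Hom_A(P_μ, P_λ)_d` with `d > 0` and
`μ ≿ λ`. -/
def traceSub (l : Irr W) : Submodule (SkewAlg n W) (P n l) :=
  ⨆ (m : Irr W) (_ : l ≤ m) (d : ℤ) (_ : 0 < d) (f : homDeg (P n m) (P n l) d),
    LinearMap.range f.1

variable (n) in
/-- `Ĩ_λ`: the sum of the images of the homogeneous `f ∈ Hom_A(P_μ, P_λ)_d` with `d > 0` and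
`μ ≻ λ`. -/
def strictTraceSub (l : Irr W) : Submodule (SkewAlg n W) (P n l) :=
  ⨆ (m : Irr W) (_ : l < m) (d : ℤ) (_ : 0 < d) (f : homDeg (P n m) (P n l) d),
    LinearMap.range f.1

variable (n) in
/-- The trace quotient module `K_λ = P_λ / I_λ`. -/
def K (l : Irr W) : GrMod (skewGr n W) :=
  (P n l).quot (traceSub n l) (isHomog_iSup _ fun _ => isHomog_iSup _ fun _ =>
    isHomog_iSup _ fun _ => isHomog_iSup _ fun _ => isHomog_iSup _ fun f => isHomog_range f.2)

variable (n) in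
/-- The strict trace quotient module `K̃_λ = P_λ / Ĩ_λ`. -/
def Ktilde (l : Irr W) : GrMod (skewGr n W) :=
  (P n l).quot (strictTraceSub n l) (isHomog_iSup _ fun _ => isHomog_iSup _ fun _ =>
    isHomog_iSup _ fun _ => isHomog_iSup _ fun _ => isHomog_iSup _ fun f => isHomog_range f.2)

theorem Ktilde_fg (l : Irr W) : (Ktilde n l).FG := by
  have : Module.Finite (SkewAlg n W) (P n l) := P_fg l
  exact inferInstanceAs (Module.Finite (SkewAlg n W) (P n l ⧸ strictTraceSub n l))

end Trace

end GrMod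

variable (n W) in
/-- The ideal of `S` generated by the homogeneous `W`-invariants of positive degree. -/
def coinvariantIdeal : Ideal (PolyRing n) :=
  Ideal.span {p | (∀ w : W, w • p = p) ∧ ∃ d : ℤ, 0 < d ∧ p ∈ polyGr n d}

end SkewGroupAlgebra

/-- The Laurent series `f` is `∑_d c_d q^d`; in particular all `c_d` are finite. -/
def IsSeriesOf (f : LaurentSeries ℤ) (c : ℤ → ℕ∞) : Prop :=
  ∀ d : ℤ, ∃ k : ℕ, f.coeff d = (k : ℤ) ∧ c d = (k : ℕ∞)

end

/-! Fix $\mu$ and put $N=K_\mu^*$. The orthogonality hypothesis makes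
$\operatorname{Hom}_A(-,N)_{-d}$ a counting device for filtration factors. Since
$\operatorname{Ext}^1_A(\widetilde K_\beta,N)$ vanishes in every degree, each sequence $0\to
M^{i+1}\to M^i\to\widetilde K_\beta\langle e\rangle\to0$ stays exact after applying it
(`precomp_surjective`, `rank_homDeg_of_exact`). The quotient contributes
$\operatorname{Hom}_A(\widetilde K_\beta,N)_{e-d}$, which has dimension $1$ if $\beta=\mu$ and
$e=d$, and $0$ otherwise. So passing from $M^i$ to $M^{i+1}$ lowers the dimension by $1$ exactly
when the factor is $\widetilde K_\mu\langle d\rangle$ (`Filtration.rank_homDeg_succ`).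

For fixed $d$ the count stops after finitely many steps. $N$ lives in degrees $\le0$, so a map of
degree $-d$ into $N$ kills everything in degrees $>d$. The components of $M$ are finite-dimensional
and vanish in low degrees, so separability forces $M^i$ into degrees $>d$ for large $i$
(`Filtration.exists_sub_gr_eq_bot`). Telescoping gives the first claim
(`Filtration.exists_count_eq_rank`), and the lower bound on the degrees of $M$ makes the
multiplicity a Laurent series.

For $M=P_\lambda$, Frobenius reciprocity gives
$\operatorname{Hom}_A(P_\lambda,N)_{-d}=\operatorname{Hom}_W(\lambda,N_{-d})$
(`P.restrict_bijective`). Flipping the pairing turns this into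
$\operatorname{Hom}_W((K_\mu)_d,\lambda^*)$ (`dualFlip_bijective`), and self-duality of $\lambda$
with Schur's lemma identifies its dimension with $[(K_\mu)_d:\lambda]$. -/

namespace GrMod

/-! ### Graded Hom spaces, exactness and shifts -/

section Graded

variable {A : Type u} [Ring A] [Algebra ℂ A] {𝒜 : ℤ → Submodule ℂ A}

theorem hom_ext {M N : GrMod 𝒜} {f g : M →ₗ[A] N} (h : ∀ i, ∀ m ∈ M.gr i, f m = g m) :
    f = g := by
  have : (⊤ : Submodule ℂ M) ≤ LinearMap.eqLocus (f.restrictScalars ℂ) (g.restrictScalars ℂ) := by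
    rw [← iSup_gr M.internal]
    exact iSup_le fun j m hm => h j m hm
  exact LinearMap.ext fun m => this trivial

theorem comp_mem_homDeg {X Y Z : GrMod 𝒜} {a b c : ℤ} {f : X →ₗ[A] Y} {g : Y →ₗ[A] Z}
    (hf : f ∈ homDeg X Y a) (hg : g ∈ homDeg Y Z b) (h : a + b = c) : g ∘ₗ f ∈ homDeg X Z c := by
  intro i m hm
  have := hg _ _ (hf i m hm)
  rwa [add_assoc, h] at this

/-- A map of degree $0$ commutes with the projections, so the degree $i$ component of any preimage
is again a preimage. -/
theorem exists_mem_gr_of_surjective {X Y : GrMod 𝒜} {f : X →ₗ[A] Y} (hf : f ∈ homDeg X Y 0)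
    (hs : Function.Surjective f) {i : ℤ} {y : Y} (hy : y ∈ Y.gr i) : ∃ x ∈ X.gr i, f x = y := by
  obtain ⟨x, rfl⟩ := hs y
  refine ⟨X.proj i x, gradedProj_mem _ _ _, ?_⟩
  have := proj_hom hf i x
  rw [add_zero] at this
  rw [← this]
  exact gradedProj_same _ hy

theorem mem_homDeg_of_comp {X Y Z : GrMod 𝒜} {n : ℤ} {f : X →ₗ[A] Y} (hf : f ∈ homDeg X Y 0)
    (hs : Function.Surjective f) {g : Y →ₗ[A] Z} (h : g ∘ₗ f ∈ homDeg X Z n) :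
    g ∈ homDeg Y Z n := by
  intro i y hy
  obtain ⟨x, hx, rfl⟩ := exists_mem_gr_of_surjective hf hs hy
  exact h i x hx

/-- Precomposition with a homomorphism of degree `0`. -/
def precomp {X Y : GrMod 𝒜} (f : X →ₗ[A] Y) (hf : f ∈ homDeg X Y 0) (N : GrMod 𝒜) (n : ℤ) :
    homDeg Y N n →ₗ[ℂ] homDeg X N n :=
  (LinearMap.lcomp ℂ N f).restrict fun _ hg => comp_mem_homDeg hf hg (zero_add n)

theorem precomp_injective {X Y : GrMod 𝒜} {f : X →ₗ[A] Y} (hf : f ∈ homDeg X Y 0)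
    (hs : Function.Surjective f) (N : GrMod 𝒜) (n : ℤ) :
    Function.Injective (precomp f hf N n) := fun _ _ h =>
  Subtype.ext ((LinearMap.cancel_right hs).1 (congrArg Subtype.val h))

theorem exists_descend {X Y N : GrMod 𝒜} {n : ℤ} {f : X →ₗ[A] Y} (hf : f ∈ homDeg X Y 0)
    (hs : Function.Surjective f) {g : X →ₗ[A] N} (hg : g ∈ homDeg X N n)
    (hker : LinearMap.ker f ≤ LinearMap.ker g) : ∃ h ∈ homDeg Y N n, h ∘ₗ f = g := by
  let h : Y →ₗ[A] N :=
    (LinearMap.ker f).liftQ g hker ∘ₗ (f.quotKerEquivOfSurjective hs).symm.toLinearMap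
  have hh : h ∘ₗ f = g := by
    refine LinearMap.ext fun x => ?_
    have : (f.quotKerEquivOfSurjective hs).symm (f x) = Submodule.Quotient.mk x := by
      rw [LinearEquiv.symm_apply_eq]
      rfl
    change (LinearMap.ker f).liftQ g hker ((f.quotKerEquivOfSurjective hs).symm (f x)) = g x
    rw [this]
    rfl
  exact ⟨h, mem_homDeg_of_comp hf hs (hh ▸ hg), hh⟩

/-- Left exactness of $\operatorname{Hom}(-,N)_n$ at the middle term; with `precomp_injective` it is
the half of exactness that needs no Ext hypothesis. -/
theorem range_precomp {X Y Z : GrMod 𝒜} {g : X →ₗ[A] Y} (hg : g ∈ homDeg X Y 0) {f : Y →ₗ[A] Z}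
    (hf : f ∈ homDeg Y Z 0) (hs : Function.Surjective f)
    (hex : LinearMap.range g = LinearMap.ker f) (N : GrMod 𝒜) (n : ℤ) :
    LinearMap.range (precomp f hf N n) = LinearMap.ker (precomp g hg N n) := by
  refine le_antisymm ?_ fun k hk => ?_
  · rintro _ ⟨k, rfl⟩
    refine Subtype.ext (LinearMap.ext fun x => ?_)
    have : g x ∈ LinearMap.ker f := hex ▸ ⟨x, rfl⟩
    exact (congrArg k.1 this).trans (map_zero _)
  · obtain ⟨h, hh, e⟩ := exists_descend (N := N) hf hs k.2 (by
      rw [← hex]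
      rintro _ ⟨x, rfl⟩
      exact LinearMap.congr_fun (congrArg Subtype.val hk) x)
    exact ⟨⟨h, hh⟩, Subtype.ext e⟩

/-- A shift keeps the carrier and the action and only relabels degrees, so the same map `f` can be
read on both sides. -/
theorem mem_homDeg_shift {X N : GrMod 𝒜} {c n : ℤ} {f : X →ₗ[A] N} :
    (f : (X.shift c) →ₗ[A] N) ∈ homDeg (X.shift c) N n ↔ f ∈ homDeg X N (n + c) := by
  constructor
  · intro h i m hm
    have h1 : m ∈ (X.shift c).gr (i + c) := by
      change m ∈ X.gr (i + c - c)
      rwa [add_sub_cancel_right]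
    have := h _ m h1
    rwa [show i + c + n = i + (n + c) by ring] at this
  · intro h i m hm
    have := h (i - c) m hm
    rwa [show i - c + (n + c) = i + n by ring] at this

/-- `Hom(X⟨c⟩, N)_n = Hom(X, N)_{n+c}`. -/
def homDegShift (X N : GrMod 𝒜) {c n k : ℤ} (h : n + c = k) :
    homDeg (X.shift c) N n ≃ₗ[ℂ] homDeg X N k where
  toFun f := ⟨f.1, h ▸ mem_homDeg_shift.1 f.2⟩
  invFun f := ⟨f.1, mem_homDeg_shift.2 (h.symm ▸ f.2)⟩
  map_add' _ _ := rfl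
  map_smul' _ _ := rfl
  left_inv _ := rfl
  right_inv _ := rfl

theorem shift_mem_homDeg {X Y : GrMod 𝒜} {f : X →ₗ[A] Y} (hf : f ∈ homDeg X Y 0) (c : ℤ) :
    (f : (X.shift c) →ₗ[A] (Y.shift c)) ∈ homDeg (X.shift c) (Y.shift c) 0 := by
  intro i m hm
  rw [add_zero]
  have := hf (i - c) m hm
  rwa [add_zero] at this

/-! ### The groups `Ext⁰` and `Ext¹` -/

section Ext

variable [GradedAlgebra 𝒜] [IsNoetherianRing A]

/-- `Ext⁰(M, N)_n = Hom(M, N)_n`. -/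
theorem nonempty_extZero (M : GrMod 𝒜) (hM : M.FG) (N : GrMod 𝒜) (n : ℤ) :
    Nonempty (Ext M hM N 0 n ≃ₗ[ℂ] homDeg M N n) := by
  let R := M.projRes hM
  have e1 : Ext M hM N 0 n ≃ₗ[ℂ] R.cocycles N 0 n := by
    refine Submodule.quotEquivOfEqBot _ ?_
    change (⊥ : Submodule ℂ _).submoduleOf _ = ⊥
    rw [Submodule.submoduleOf, Submodule.comap_bot, Submodule.ker_subtype]
  let φ : homDeg M N n →ₗ[ℂ] R.cocycles N 0 n :=
    (LinearMap.lcomp ℂ N R.ε).restrict fun g hg =>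
      ⟨comp_mem_homDeg R.ε_deg hg (zero_add n), by
        refine LinearMap.ext fun x => ?_
        have : R.d 0 x ∈ LinearMap.ker R.ε := R.exact_zero ▸ ⟨x, rfl⟩
        exact (congrArg g this).trans (map_zero _)⟩
  have hφ : Function.Bijective φ := by
    refine ⟨fun a b h => Subtype.ext ((LinearMap.cancel_right R.ε_surj).1
      (congrArg Subtype.val h)), fun k => ?_⟩
    obtain ⟨h, hh, e⟩ := exists_descend (N := N) R.ε_deg R.ε_surj k.2.1 (by
      rw [← R.exact_zero]
      rintro _ ⟨x, rfl⟩
      exact LinearMap.congr_fun k.2.2 x)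
    exact ⟨⟨h, hh⟩, Subtype.ext e⟩
  exact ⟨e1.trans (LinearEquiv.ofBijective φ hφ).symm⟩

/-- If `Ext¹(Z, N)_n = 0`, then homomorphisms of degree `n` to `N` extend along the kernel of a
surjection onto `Z`. -/
theorem precomp_surjective {X Y Z : GrMod 𝒜} (hY : Y.FG) (hZ : Z.FG) {g : X →ₗ[A] Y}
    (hg : g ∈ homDeg X Y 0) (hi : Function.Injective g) {f : Y →ₗ[A] Z}
    (hf : f ∈ homDeg Y Z 0) (hs : Function.Surjective f)
    (hex : LinearMap.range g = LinearMap.ker f) (N : GrMod 𝒜) (n : ℤ)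
    (hExt : Subsingleton (Ext Z hZ N 1 n)) : Function.Surjective (precomp g hg N n) := by
  rintro ⟨h, hh⟩
  let R := Z.projRes hZ
  -- Lift the augmentation $P_0\to Z$ through $Y\to Z$. On boundaries the lift lands in the image of
  -- $X$, which yields $\varphi:P_1\to X$, the cocycle describing the extension.
  obtain ⟨l, hl, hfl⟩ := R.projective 0 Y Z hY hZ f hf hs R.ε R.ε_deg
  have hld : ∀ q, ∃ x, g x = l (R.d 0 q) := fun q => by
    change l (R.d 0 q) ∈ LinearMap.range g
    have h1 : R.d 0 q ∈ LinearMap.ker R.ε := R.exact_zero ▸ ⟨q, rfl⟩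
    rw [hex, LinearMap.mem_ker]
    exact (LinearMap.congr_fun hfl _).trans h1
  let φ : R.P 1 →ₗ[A] X :=
    (LinearEquiv.ofInjective g hi).symm.toLinearMap ∘ₗ
      (l ∘ₗ R.d 0).codRestrict (LinearMap.range g) hld
  have hφ : ∀ q, g (φ q) = l (R.d 0 q) := fun q =>
    congrArg Subtype.val ((LinearEquiv.ofInjective g hi).apply_symm_apply
      ((l ∘ₗ R.d 0).codRestrict (LinearMap.range g) hld q))
  have hφdeg : φ ∈ homDeg (R.P 1) X 0 := by
    intro i q hq
    rw [add_zero]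
    have h2 : l (R.d 0 q) ∈ Y.gr i := by
      have := hl _ _ (R.d_deg 0 i q hq)
      rwa [add_zero, add_zero] at this
    have h3 : X.proj i (φ q) = φ q := by
      apply hi
      have := proj_hom hg i (φ q)
      rw [add_zero] at this
      rw [← this, hφ]
      exact gradedProj_same _ h2
    rw [← h3]
    exact gradedProj_mem _ _ _
  -- The class of $h\circ\varphi$ in $\operatorname{Ext}^1(Z,N)_n$ is the obstruction to extending
  -- $h$. Its vanishing provides $k:P_0\to N$ with $k\circ d_0=h\circ\varphi$.
  have hcoc : h ∘ₗ φ ∈ R.cocycles N 1 n := by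
    refine ⟨comp_mem_homDeg hφdeg hh (zero_add n), LinearMap.ext fun q => ?_⟩
    have h1 : R.d 0 (R.d 1 q) = 0 := by
      have : R.d 1 q ∈ LinearMap.ker (R.d 0) := R.exact_succ 0 ▸ ⟨q, rfl⟩
      exact this
    have h2 : φ (R.d 1 q) = 0 := hi (by rw [hφ, h1, map_zero, map_zero])
    exact (congrArg h h2).trans (map_zero _)
  have hcob : h ∘ₗ φ ∈ R.coboundaries N n 1 := by
    have := Submodule.Quotient.subsingleton_iff.1 hExt
    have h1 : (⟨h ∘ₗ φ, hcoc⟩ : R.cocycles N 1 n) ∈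
        (R.coboundaries N n 1).submoduleOf (R.cocycles N 1 n) := by
      rw [this]
      trivial
    exact h1
  obtain ⟨k, hk, hkd⟩ := hcob
  -- $Y$ is the quotient of $X\oplus P_0$ by the pairs $(-\varphi(q),d_0q)$. The map $(h,k)$
  -- vanishes on these pairs by the choice of $k$, so it descends to the desired extension of $h$.
  let σ : (X × R.P 0) →ₗ[A] Y := g.coprod l
  let τ : (X × R.P 0) →ₗ[A] N := h.coprod k
  have hσ : ∀ y, ∃ x p, g x + l p = y := by
    intro y
    obtain ⟨p, hp⟩ := R.ε_surj (f y)
    have : y - l p ∈ LinearMap.range g := by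
      rw [hex, LinearMap.mem_ker, map_sub, sub_eq_zero, ← hp]
      exact (LinearMap.congr_fun hfl p).symm
    obtain ⟨x, hx⟩ := this
    exact ⟨x, p, by rw [hx, sub_add_cancel]⟩
  have hσs : Function.Surjective σ := fun y =>
    let ⟨x, p, h⟩ := hσ y
    ⟨(x, p), h⟩
  have hker : LinearMap.ker σ ≤ LinearMap.ker τ := by
    rintro ⟨x, p⟩ hxp
    have hxp' : g x + l p = 0 := hxp
    have h1 : R.ε p = 0 := by
      have h2 : f (g x) = 0 := by
        have : g x ∈ LinearMap.ker f := hex ▸ ⟨x, rfl⟩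
        exact this
      have h3 := congrArg f hxp'
      rw [map_add, h2, zero_add, map_zero] at h3
      exact (LinearMap.congr_fun hfl p).symm.trans h3
    have h2 : p ∈ LinearMap.range (R.d 0) := R.exact_zero ▸ h1
    obtain ⟨q, rfl⟩ := h2
    have h3 : x = -φ q := hi (by
      rw [map_neg, hφ]
      exact eq_neg_of_add_eq_zero_left hxp')
    have h4 : k (R.d 0 q) = h (φ q) := LinearMap.congr_fun hkd q
    change h x + k (R.d 0 q) = 0
    rw [h3, h4, map_neg, neg_add_cancel]
  let e : Y →ₗ[A] N :=
    (LinearMap.ker σ).liftQ τ hker ∘ₗ (σ.quotKerEquivOfSurjective hσs).symm.toLinearMap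
  have he : ∀ x p, e (g x + l p) = h x + k p := by
    intro x p
    have : (σ.quotKerEquivOfSurjective hσs).symm (g x + l p) =
        Submodule.Quotient.mk ((x, p) : X × R.P 0) := by
      rw [LinearEquiv.symm_apply_eq]
      rfl
    change (LinearMap.ker σ).liftQ τ hker ((σ.quotKerEquivOfSurjective hσs).symm _) = _
    rw [this]
    rfl
  -- The product $X\times P_0$ carries no `GrMod` structure here, so the degree is checked by
  -- replacing $x$ and $p$ by their components of degree $i$, which does not change $g(x)+l(p)$.
  have hedeg : e ∈ homDeg Y N n := by
    intro i y hy
    obtain ⟨x, p, rfl⟩ := hσ y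
    have h1 := proj_hom hg i x
    have h2 := proj_hom hl i p
    rw [add_zero] at h1 h2
    have h3 : g (X.proj i x) + l ((R.P 0).proj i p) = g x + l p := by
      rw [← h1, ← h2, ← map_add]
      exact gradedProj_same _ hy
    rw [← h3, he]
    exact (N.gr _).add_mem (hh _ _ (gradedProj_mem _ _ _)) (hk _ _ (gradedProj_mem _ _ _))
  refine ⟨⟨e, hedeg⟩, Subtype.ext (LinearMap.ext fun x => ?_)⟩
  change e (g x) = h x
  have := he x 0
  rwa [map_zero, map_zero, add_zero, add_zero] at this

/-- Rank-nullity for restriction along $g$: its range is everything by the Ext vanishing, and its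
kernel is $\operatorname{Hom}(Z,N)_n$. As an identity of cardinals it needs no finiteness of the Hom
spaces. -/
theorem rank_homDeg_of_exact {X Y Z : GrMod 𝒜} (hY : Y.FG) (hZ : Z.FG) {g : X →ₗ[A] Y}
    (hg : g ∈ homDeg X Y 0) (hi : Function.Injective g) {f : Y →ₗ[A] Z}
    (hf : f ∈ homDeg Y Z 0) (hs : Function.Surjective f)
    (hex : LinearMap.range g = LinearMap.ker f) (N : GrMod 𝒜) (n : ℤ)
    (hExt : Subsingleton (Ext Z hZ N 1 n)) :
    Module.rank ℂ (homDeg Y N n) = Module.rank ℂ (homDeg X N n) + Module.rank ℂ (homDeg Z N n) := by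
  rw [← LinearMap.rank_range_add_rank_ker (precomp g hg N n),
    LinearMap.range_eq_top.2 (precomp_surjective hY hZ hg hi hf hs hex N n hExt), rank_top,
    ← range_precomp hg hf hs hex,
    ← (LinearEquiv.ofInjective _ (precomp_injective hf hs N n)).rank_eq]

end Ext

end Graded

end GrMod

namespace GrMod

/-! ### Counting filtration factors by dimensions of Hom spaces -/

section Count

variable {A : Type u} [Ring A] [Algebra ℂ A] {𝒜 : ℤ → Submodule ℂ A}

theorem rank_homDeg_of_iso {X Y : GrMod 𝒜} (h : X.Iso Y) (N : GrMod 𝒜) (n : ℤ) :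
    Module.rank ℂ (homDeg X N n) = Module.rank ℂ (homDeg Y N n) := by
  obtain ⟨e, he⟩ := h
  have h1 : (e : X →ₗ[A] Y) ∈ homDeg X Y 0 := fun i m hm => by
    rw [add_zero]
    exact (he i m).1 hm
  have h2 : (e.symm : Y →ₗ[A] X) ∈ homDeg Y X 0 := fun i m hm => by
    rw [add_zero]
    refine (he i _).2 ?_
    rwa [LinearEquiv.coe_coe, e.apply_symm_apply]
  refine (LinearEquiv.ofLinearMap (precomp _ h2 N n) (precomp _ h1 N n) ?_ ?_).rank_eq
  · refine LinearMap.ext fun f => Subtype.ext (LinearMap.ext fun x => ?_)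
    exact congrArg f.1 (e.apply_symm_apply x)
  · refine LinearMap.ext fun f => Subtype.ext (LinearMap.ext fun x => ?_)
    exact congrArg f.1 (e.symm_apply_apply x)

theorem rank_homDeg_of_subsingleton {X : GrMod 𝒜} [Subsingleton X] (N : GrMod 𝒜) (n : ℤ) :
    Module.rank ℂ (homDeg X N n) = 0 := by
  have : Subsingleton (homDeg X N n) := ⟨fun f g => Subtype.ext (LinearMap.ext fun x => by
    rw [Subsingleton.elim x 0, map_zero, map_zero])⟩
  exact rank_subsingleton' ℂ _

/-- Equal submodules give graded modules of different types, with different homogeneity proofs;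
substituting the equality once here avoids transport later. -/
theorem rank_homDeg_sub_congr {M : GrMod 𝒜} {N₁ N₂ : Submodule A M} (h : N₁ = N₂)
    (h₁ : M.IsHomog N₁) (h₂ : M.IsHomog N₂) (N : GrMod 𝒜) (n : ℤ) :
    Module.rank ℂ (homDeg (M.sub N₁ h₁) N n) = Module.rank ℂ (homDeg (M.sub N₂ h₂) N n) := by
  subst h
  rfl

theorem rank_homDeg_sub_top {M : GrMod 𝒜} {N₁ : Submodule A M} (h : N₁ = ⊤)
    (h₁ : M.IsHomog N₁) (N : GrMod 𝒜) (n : ℤ) :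
    Module.rank ℂ (homDeg (M.sub N₁ h₁) N n) = Module.rank ℂ (homDeg M N n) := by
  subst h
  exact rank_homDeg_of_iso ⟨Submodule.topEquiv, fun i m => Iff.rfl⟩ N n

open Classical in
-- Orthogonality speaks of equal labels, whereas factors are counted up to isomorphism. The two
-- conditions agree because $N$ detects the label: an isomorphism $F_\beta\langle e\rangle\cong
-- F_\alpha\langle d\rangle$ makes $\operatorname{Hom}(F_\beta,N)_{e-d}$ one-dimensional, which
-- orthogonality allows only for $e=d$ and $\beta=\alpha$.
theorem rank_homDeg_shift_of_orthogonal {ι : Type*} {F : ι → GrMod 𝒜} {N : GrMod 𝒜} {α : ι}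
    (h0 : ∀ β k, Module.rank ℂ (homDeg (F β) N k) = if k = 0 ∧ β = α then 1 else 0)
    (β : ι) (d e : ℤ) :
    Module.rank ℂ (homDeg (F β) N (e - d)) =
      if ((F β).shift e).Iso ((F α).shift d) then 1 else 0 := by
  rw [h0]
  refine if_congr ⟨?_, fun h => ?_⟩ rfl rfl
  · rintro ⟨h, rfl⟩
    obtain rfl : e = d := by omega
    exact ⟨LinearEquiv.refl A _, fun _ _ => Iff.rfl⟩
  · have h1 := rank_homDeg_of_iso h N (-d)
    rw [(homDegShift (F β) N (show -d + e = e - d by ring)).rank_eq,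
      (homDegShift (F α) N (show -d + d = 0 by ring)).rank_eq, h0 β, h0 α,
      if_pos (c := (0 : ℤ) = 0 ∧ α = α) ⟨rfl, rfl⟩] at h1
    by_contra h2
    rw [if_neg h2] at h1
    exact zero_ne_one h1

/-- A nonzero component $X_i$ has $i>d$, and a map of degree $-d$ sends it to $N_{i-d}$, which is
zero because $i-d>0$. -/
theorem rank_homDeg_eq_zero {X N : GrMod 𝒜} {d : ℤ} (hX : ∀ i ≤ d, X.gr i = ⊥)
    (hN : ∀ i, 0 < i → N.gr i = ⊥) : Module.rank ℂ (homDeg X N (-d)) = 0 := by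
  have : Subsingleton (homDeg X N (-d)) := by
    refine ⟨fun f g => Subtype.ext (hom_ext fun i m hm => ?_)⟩
    rcases le_or_gt i d with hi | hi
    · rw [hX i hi, Submodule.mem_bot] at hm
      rw [hm, map_zero, map_zero]
    · have hz : ∀ f : homDeg X N (-d), f.1 m = 0 := fun f => by
        have := f.2 i m hm
        rwa [hN _ (by omega), Submodule.mem_bot] at this
      rw [hz f, hz g]
  exact rank_subsingleton' ℂ _

variable [GradedAlgebra 𝒜] [IsNoetherianRing A]

open Classical in
theorem Filtration.rank_homDeg_succ {ι : Type*} {F : ι → GrMod 𝒜} (hF : ∀ β, (F β).FG)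
    {N : GrMod 𝒜} {α : ι}
    (h0 : ∀ β k, Module.rank ℂ (homDeg (F β) N k) = if k = 0 ∧ β = α then 1 else 0)
    (h1 : ∀ β k, Subsingleton (Ext (F β) (hF β) N 1 k)) {M : GrMod 𝒜} (hM : M.FG)
    (Φ : Filtration F M) (d : ℤ) (i : ℕ) :
    Module.rank ℂ (homDeg (M.sub (Φ.N i) (Φ.homog i)) N (-d)) =
      Module.rank ℂ (homDeg (M.sub (Φ.N (i + 1)) (Φ.homog (i + 1))) N (-d)) +
        if (Φ.factor i).Iso ((F α).shift d) then 1 else 0 := by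
  rcases Φ.factor_cases i with hsub | ⟨β, e, E, hE⟩
  · have hle : Φ.N (i + 1) = Φ.N i := by
      refine le_antisymm (Φ.anti i) ?_
      have := Submodule.Quotient.subsingleton_iff.1 hsub
      exact fun x hx => Submodule.eq_top_iff'.1 this ⟨x, hx⟩
    -- A zero factor is never counted, since $F_\alpha$ has a nonzero map to $N$ and hence is not
    -- zero.
    have hn : ¬ (Φ.factor i).Iso ((F α).shift d) := by
      rintro ⟨E, -⟩
      have : Subsingleton (Φ.factor i) := hsub
      have : Subsingleton (F α) := E.symm.toEquiv.subsingleton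
      have h2 := rank_homDeg_of_subsingleton (X := F α) N 0
      rw [h0, if_pos ⟨rfl, rfl⟩] at h2
      exact one_ne_zero h2
    rw [if_neg hn, add_zero]
    exact rank_homDeg_sub_congr hle.symm _ _ N _
  · let X := M.sub (Φ.N (i + 1)) (Φ.homog (i + 1))
    let Y := M.sub (Φ.N i) (Φ.homog i)
    have hY : Y.FG := by
      have : Module.Finite A M := hM
      have : IsNoetherian A M := isNoetherian_of_isNoetherianRing_of_finite A _
      exact inferInstanceAs (Module.Finite A (Φ.N i))
    let q : Y →ₗ[A] Φ.factor i := ((Φ.N (i + 1)).submoduleOf (Φ.N i)).mkQ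
    let f : Y →ₗ[A] F β := E.toLinearMap ∘ₗ q
    let g : X →ₗ[A] Y := Submodule.inclusion (Φ.anti i)
    have hg : g ∈ homDeg X Y 0 := fun j m hm => by
      rw [add_zero]
      exact hm
    -- The Ext vanishing is given for the unshifted $F_\beta$, so the whole sequence is shifted by
    -- $-e$; the degree $-d$ then becomes $e-d$.
    have hf : (f : Y.shift (-e) →ₗ[A] F β) ∈ homDeg (Y.shift (-e)) (F β) 0 := by
      intro j m hm
      have h2 := (hE (j - -e) (q m)).1 ⟨m, hm, rfl⟩
      have h3 : E (q m) ∈ (F β).gr (j - -e - e) := h2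
      rwa [show j - -e - e = j + 0 by ring] at h3
    have hs : Function.Surjective f :=
      E.surjective.comp ((Φ.N (i + 1)).submoduleOf (Φ.N i)).mkQ_surjective
    have hex : LinearMap.range g = LinearMap.ker f := by
      have hker : ∀ y : Y, f y = 0 ↔ (y : Φ.N i).1 ∈ Φ.N (i + 1) := fun y =>
        E.map_eq_zero_iff.trans
          (Submodule.Quotient.mk_eq_zero ((Φ.N (i + 1)).submoduleOf (Φ.N i)))
      refine Submodule.ext fun y => ⟨?_, fun hy => ⟨⟨_, (hker y).1 hy⟩, rfl⟩⟩
      rintro ⟨x, rfl⟩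
      exact (hker _).2 x.2
    have key := rank_homDeg_of_exact (X := X.shift (-e)) (Y := Y.shift (-e)) (Z := F β) hY (hF β)
      (shift_mem_homDeg hg (-e)) (Submodule.inclusion_injective (Φ.anti i)) hf hs hex N (e - d)
      (h1 β _)
    rw [(homDegShift X N (show e - d + -e = -d by ring)).rank_eq,
      (homDegShift Y N (show e - d + -e = -d by ring)).rank_eq,
      rank_homDeg_shift_of_orthogonal h0] at key
    refine key.trans (congrArg _ (if_congr ?_ rfl rfl))
    have hEiso : (Φ.factor i).Iso ((F β).shift e) := ⟨E, hE⟩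
    have hsymm : ∀ {X Y : GrMod 𝒜}, X.Iso Y → Y.Iso X := fun ⟨E, h⟩ =>
      ⟨E.symm, fun i m => by rw [h, E.apply_symm_apply]⟩
    have htrans : ∀ {X Y Z : GrMod 𝒜}, X.Iso Y → Y.Iso Z → X.Iso Z := fun ⟨E, h⟩ ⟨E', h'⟩ =>
      ⟨E.trans E', fun i m => (h i m).trans (h' i _)⟩
    exact ⟨fun h => htrans hEiso h, fun h => htrans (hsymm hEiso) h⟩

/-- If `Hom` and `Ext¹` from the members of `F` to `N` are those of an orthogonal family and the
late terms of an `F`-filtration of `M` have no homomorphisms of degree `-d` to `N`, then the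
multiplicity of `F_α⟨d⟩` is the dimension of `Hom(M, N)_{-d}`. -/
theorem Filtration.exists_count_eq_rank {ι : Type*} {F : ι → GrMod 𝒜} (hF : ∀ β, (F β).FG)
    {N : GrMod 𝒜} {α : ι}
    (h0 : ∀ β k, (k = 0 ∧ β = α → Module.rank ℂ (homDeg (F β) N k) = 1) ∧
      (¬ (k = 0 ∧ β = α) → Module.rank ℂ (homDeg (F β) N k) = 0))
    (h1 : ∀ β k, Subsingleton (Ext (F β) (hF β) N 1 k)) {M : GrMod 𝒜} (hM : M.FG)
    (Φ : Filtration F M) (d : ℤ) (i₀ : ℕ)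
    (hi₀ : ∀ i, i₀ ≤ i → Module.rank ℂ (homDeg (M.sub (Φ.N i) (Φ.homog i)) N (-d)) = 0) :
    ∃ k : ℕ, Φ.count α d = k ∧ Module.rank ℂ (homDeg M N (-d)) = k := by
  classical
  have h0' : ∀ β k, Module.rank ℂ (homDeg (F β) N k) = if k = 0 ∧ β = α then 1 else 0 := by
    intro β k
    split_ifs with h
    exacts [(h0 β k).1 h, (h0 β k).2 h]
  have step := Φ.rank_homDeg_succ hF h0' h1 hM d
  let p : ℕ → Prop := fun i => (Φ.factor i).Iso ((F α).shift d)
  -- From $i_0$ on both ranks in the step formula are zero, so a counted factor would give $0=0+1$.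
  have hlt : ∀ i, p i → i < i₀ := by
    intro i hi
    by_contra hlt
    have := step i
    rw [if_pos hi, hi₀ i (by omega), hi₀ (i + 1) (by omega), zero_add] at this
    exact zero_ne_one this
  have hsum : ∀ j, Module.rank ℂ (homDeg M N (-d)) =
      Module.rank ℂ (homDeg (M.sub (Φ.N j) (Φ.homog j)) N (-d)) +
        ((((Finset.range j).filter p).card : ℕ) : Cardinal) := by
    intro j
    induction j with
    | zero => simpa using (rank_homDeg_sub_top Φ.top (Φ.homog 0) N (-d)).symm
    | succ j ih =>
      rw [ih, step j, Finset.range_add_one, Finset.filter_insert, add_assoc]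
      congr 1
      change (if p j then (1 : Cardinal) else 0) + _ = _
      split_ifs with h
      · rw [Finset.card_insert_of_notMem (by simp)]
        push_cast
        exact add_comm _ _
      · rw [zero_add]
  refine ⟨((Finset.range i₀).filter p).card, ?_, ?_⟩
  · have : {i | p i} = ((Finset.range i₀).filter p : Finset ℕ) := by
      ext i
      simpa using hlt i
    change {i | p i}.encard = _
    rw [this, Set.encard_coe_eq_coe_finsetCard]
  · rw [hsum i₀, hi₀ i₀ le_rfl, zero_add]

end Count

end GrMod

/-- The dimension of the space of homomorphisms to a simple module is the length of the isotypic
component. -/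
theorem rank_linearMap_eq_length_isotypicComponent {k R : Type*} {V S : Type u} [Field k] [IsAlgClosed k]
    [Ring R] [Algebra k R] [AddCommGroup V] [Module k V] [Module R V] [IsScalarTower k R V]
    [AddCommGroup S] [Module k S] [Module R S] [IsScalarTower k R S]
    [FiniteDimensional k V] [FiniteDimensional k S] [IsSemisimpleModule R V] [IsSimpleModule R S] :
    Cardinal.toENat (Module.rank k (V →ₗ[R] S)) = Module.length R (isotypicComponent R V S) := by
  have : Module.Finite R V := Module.Finite.of_restrictScalars_finite k R V
  have : IsNoetherian k V := inferInstance
  have : Module.Finite R (isotypicComponent R V S) := by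
    have : Module.Finite k (isotypicComponent R V S) :=
      inferInstanceAs (Module.Finite k ((isotypicComponent R V S).restrictScalars k))
    exact Module.Finite.of_restrictScalars_finite k R _
  obtain ⟨m, ⟨e⟩⟩ := (IsIsotypicOfType.isotypicComponent R V S).linearEquiv_fun
  obtain ⟨C, hC⟩ := exists_isCompl (isotypicComponent R V S)
  -- A nonzero map from the complement $C$ to the simple $S$ splits and embeds $S$ in $C$; but every
  -- copy of $S$ lies in the isotypic component, which meets $C$ in $0$.
  have hzero : ∀ f : V →ₗ[R] S, f ∘ₗ C.subtype = 0 := by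
    intro f
    by_contra hne
    obtain ⟨g, hg⟩ := IsSemisimpleModule.lifting_property (f ∘ₗ C.subtype)
      ((LinearMap.surjective_or_eq_zero _).resolve_right hne) .id
    have hinj : Function.Injective (C.subtype ∘ₗ g) :=
      C.subtype_injective.comp (LinearMap.injective_of_comp_eq_id _ _ hg)
    have hle : LinearMap.range (C.subtype ∘ₗ g) ≤ isotypicComponent R V S :=
      le_sSup ⟨(LinearEquiv.ofInjective _ hinj).symm⟩
    have := IsSimpleModule.nontrivial R S
    obtain ⟨s, hs⟩ := exists_ne (0 : S)
    refine hs (hinj ?_)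
    rw [map_zero]
    exact Submodule.disjoint_def.1 hC.disjoint _ (hle ⟨s, rfl⟩) (g s).2
  let r : (V →ₗ[R] S) →ₗ[k] (isotypicComponent R V S →ₗ[R] S) :=
    LinearMap.lcomp k S (isotypicComponent R V S).subtype
  have hr : Function.Bijective r := by
    refine ⟨fun f g h => ?_, fun f => ?_⟩
    · refine LinearMap.ext fun x => ?_
      have hx : x ∈ isotypicComponent R V S ⊔ C := by rw [hC.sup_eq_top]; trivial
      obtain ⟨a, ha, c, hc, rfl⟩ := Submodule.mem_sup.1 hx
      rw [map_add, map_add]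
      have h1 : f a = g a := LinearMap.congr_fun h ⟨a, ha⟩
      have h2 : f c = 0 := LinearMap.congr_fun (hzero f) ⟨c, hc⟩
      have h3 : g c = 0 := LinearMap.congr_fun (hzero g) ⟨c, hc⟩
      rw [h1, h2, h3]
    · refine ⟨f ∘ₗ Submodule.projectionOnto _ _ hC, LinearMap.ext fun x => ?_⟩
      exact congrArg f (Submodule.projectionOnto_apply_left hC x)
  -- Schur's lemma over an algebraically closed field. As the isotypic component is $S^m$, both
  -- sides of the claim are then $m$.
  have h1 : Module.rank k (S →ₗ[R] S) = 1 := by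
    have := IsSimpleModule.algebraMap_end_bijective_of_isAlgClosed (A := R) (V := S) k
    rw [Module.rank_eq_one_iff_finrank_eq_one,
      ← (LinearEquiv.ofBijective (Algebra.linearMap k (Module.End R S)) this).finrank_eq,
      Module.finrank_self]
  have h2 : Module.rank k (V →ₗ[R] S) = m := by
    rw [(LinearEquiv.ofBijective r hr).rank_eq]
    let e' : (isotypicComponent R V S →ₗ[R] S) ≃ₗ[k] ((Fin m → S) →ₗ[R] S) :=
      e.congrLeft S k
    rw [e'.rank_eq, ← (LinearMap.lsum R (fun _ : Fin m => S) k).rank_eq, rank_pi]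
    simp only [h1]
    simp
  rw [h2, e.length_eq, Module.length_pi_of_fintype]
  simp

/-! ### Boundedness and finite-dimensionality of graded components -/

section Finiteness

/-- Compares the integer weights used for the grading with natural-number weights, for which finite
generation of the homogeneous parts is available. -/
theorem polyGr_weight_eq {n : ℕ} {i : ℤ} {p : PolyRing n} (hp : p ∈ polyGr n i) {d : Fin n →₀ ℕ}
    (hd : MvPolynomial.coeff d p ≠ 0) : ((Finsupp.weight (fun _ => (1 : ℕ)) d : ℕ) : ℤ) = i := by
  rw [← hp hd, Finsupp.weight_apply, Finsupp.weight_apply]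
  simp [Finsupp.sum]

theorem polyGr_eq_bot {n : ℕ} {i : ℤ} (hi : i < 0) : polyGr n i = ⊥ := by
  refine (Submodule.eq_bot_iff _).2 fun p hp => MvPolynomial.ext _ _ fun d => ?_
  rw [MvPolynomial.coeff_zero]
  by_contra hd
  have := polyGr_weight_eq hp hd
  omega

instance finiteDimensional_polyGr {n : ℕ} (i : ℤ) : FiniteDimensional ℂ (polyGr n i) := by
  rcases lt_or_ge i 0 with hi | hi
  · rw [polyGr_eq_bot hi]
    infer_instance
  · lift i to ℕ using hi
    have : FiniteDimensional ℂ
        (MvPolynomial.weightedHomogeneousSubmodule ℂ (fun _ : Fin n => (1 : ℕ)) i) :=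
      Module.Finite.iff_fg.2
        (MvPolynomial.weightedHomogeneousSubmodule_fg ℂ _ (fun _ => one_ne_zero) i)
    refine Submodule.finiteDimensional_of_le
      (S₂ := MvPolynomial.weightedHomogeneousSubmodule ℂ (fun _ : Fin n => (1 : ℕ)) i) ?_
    intro p hp d hd
    exact_mod_cast polyGr_weight_eq hp hd

theorem skewGr_eq_bot {n : ℕ} {W : Type u} {i : ℤ} (hi : i < 0) : skewGr n W i = ⊥ := by
  refine (Submodule.eq_bot_iff _).2 fun a ha => ?_
  ext1 w
  have := ha w
  rwa [polyGr_eq_bot hi, Submodule.mem_bot] at this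

variable {n : ℕ} {W : Type u} [Group W] [MulSemiringAction W (PolyRing n)]
  [SMulCommClass W ℂ (PolyRing n)]

instance finiteDimensional_skewGr [Finite W] (i : ℤ) : FiniteDimensional ℂ (skewGr n W i) := by
  let φ : skewGr n W i →ₗ[ℂ] (W → polyGr n i) :=
    { toFun := fun a w => ⟨a.1.coeff w, a.2 w⟩
      map_add' := fun a b => funext fun w => Subtype.ext (by
        change (a.1 + b.1).coeff w = _
        rw [SkewMonoidAlgebra.coeff_add]
        rfl)
      map_smul' := fun c a => funext fun w => Subtype.ext (by
        change (c • a.1).coeff w = _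
        rw [SkewMonoidAlgebra.coeff_smul]
        rfl) }
  refine Module.Finite.of_injective φ fun a b h => Subtype.ext ?_
  ext1 w
  exact congrArg Subtype.val (congrFun h w)

namespace GrMod

variable [IsGradedAction n W]

theorem FG.exists_gr_eq_bot {M : GrMod (skewGr n W)} (hM : M.FG) :
    ∃ b : ℤ, ∀ i < b, M.gr i = ⊥ := by
  obtain ⟨k, deg, f, hf, hs⟩ := exists_cover M hM
  obtain ⟨b, hb⟩ := (Set.finite_range deg).bddBelow
  refine ⟨b, fun i hi => (Submodule.eq_bot_iff _).2 fun y hy => ?_⟩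
  obtain ⟨x, hx, rfl⟩ := exists_mem_gr_of_surjective hf hs hy
  have : x = 0 := by
    funext j
    have h1 : (x : Fin k → SkewAlg n W) j ∈ skewGr n W (i - deg j) := hx j trivial
    have h2 : b ≤ deg j := hb ⟨j, rfl⟩
    rwa [skewGr_eq_bot (show i - deg j < 0 by omega), Submodule.mem_bot] at h1
  rw [this, map_zero]

theorem FG.finiteDimensional_gr [Finite W] {M : GrMod (skewGr n W)} (hM : M.FG) (i : ℤ) :
    FiniteDimensional ℂ (M.gr i) := by
  obtain ⟨k, deg, f, hf, hs⟩ := exists_cover M hM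
  let φ : (∀ j, skewGr n W (i - deg j)) →ₗ[ℂ] M.gr i :=
    { toFun := fun x => ⟨f (fun j => (x j).1), by
        have := hf i (fun j => (x j).1) fun j _ => (x j).2
        rwa [add_zero] at this⟩
      map_add' := fun _ _ => Subtype.ext (map_add f _ _)
      map_smul' := fun c _ => Subtype.ext ((f.restrictScalars ℂ).map_smul c _) }
  have : Module.Finite ℂ (∀ j, skewGr n W (i - deg j)) := Module.Finite.pi
  refine Module.Finite.of_surjective φ fun y => ?_
  obtain ⟨x, hx, hxy⟩ := exists_mem_gr_of_surjective hf hs y.2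
  exact ⟨fun j => ⟨(x : Fin k → SkewAlg n W) j, hx j trivial⟩, Subtype.ext hxy⟩

theorem P_gr_eq_bot (l : Irr W) {i : ℤ} (hi : i < 0) : (P n l).gr i = ⊥ := by
  refine (Submodule.eq_bot_iff _).2 ?_
  rintro _ ⟨x, rfl⟩
  have : (polyGr n i).subtype = 0 := LinearMap.ext fun p => by
    exact (Submodule.mem_bot ℂ).1 ((polyGr_eq_bot hi).le p.2)
  rw [this, LinearMap.rTensor_zero, LinearMap.zero_apply]
  rfl

theorem K_gr_eq_bot [Preorder (Irr W)] (l : Irr W) {i : ℤ} (hi : i < 0) : (K n l).gr i = ⊥ := by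
  change ((P n l).gr i).map _ = ⊥
  rw [P_gr_eq_bot l hi, Submodule.map_bot]

theorem K_fg [Preorder (Irr W)] (l : Irr W) : (K n l).FG := by
  have : Module.Finite (SkewAlg n W) (P n l) := P_fg l
  exact inferInstanceAs (Module.Finite (SkewAlg n W) (P n l ⧸ traceSub n l))

theorem dual_ext {M : GrMod (skewGr n W)} {f g : dual M}
    (h : ∀ j, ∀ m ∈ M.gr j, (f : dualCarrier M).1 m = (g : dualCarrier M).1 m) : f = g := by
  refine Subtype.ext (LinearMap.ext fun m => ?_)
  have : (⊤ : Submodule ℂ M) ≤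
      LinearMap.eqLocus (f : dualCarrier M).1 (g : dualCarrier M).1 := by
    rw [← iSup_gr M.internal]
    exact iSup_le fun j m hm => h j m hm
  exact this trivial

theorem dual_gr_eq_bot {M : GrMod (skewGr n W)} {i : ℤ} (hi : M.gr (-i) = ⊥) :
    (dual M).gr i = ⊥ := by
  refine (Submodule.eq_bot_iff _).2 fun f hf => dual_ext fun j m hm => ?_
  by_cases hj : j = -i
  · subst hj
    rw [hi, Submodule.mem_bot] at hm
    rw [hm, map_zero, map_zero]
  · exact hf j hj m hm

/-- The chain $M^i\cap M_j$ descends in the finite-dimensional space $M_j$, so it stabilizes. Its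
stable value lies in every $M^k$, hence is zero by separability. -/
theorem Filtration.exists_inf_gr_eq_bot [Finite W] {ι : Type*} {F : ι → GrMod (skewGr n W)}
    {M : GrMod (skewGr n W)} (hM : M.FG) (Φ : Filtration F M) (j : ℤ) :
    ∃ i₀, ∀ i, i₀ ≤ i → ∀ x ∈ Φ.N i, x ∈ M.gr j → x = 0 := by
  have := hM.finiteDimensional_gr j
  have hanti : Antitone Φ.N := antitone_nat_of_succ_le Φ.anti
  let a : ℕ →o (Submodule ℂ (M.gr j))ᵒᵈ :=
    ⟨fun i => OrderDual.toDual (((Φ.N i).restrictScalars ℂ).comap (M.gr j).subtype),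
      fun i i' h x hx => hanti h hx⟩
  obtain ⟨i₀, h⟩ := IsArtinian.monotone_stabilizes a
  refine ⟨i₀, fun i hi x hx hxj => ?_⟩
  have hmem : ∀ k, x ∈ Φ.N k := by
    intro k
    have h1 : (⟨x, hxj⟩ : M.gr j) ∈ OrderDual.ofDual (a i) := hx
    rw [← h i hi, h (max i₀ k) (le_max_left _ _)] at h1
    exact hanti (le_max_right i₀ k) h1
  have := (Submodule.mem_iInf Φ.N).2 hmem
  rwa [Φ.separable] at this

/-- The late terms of a separable filtration live in large degrees. -/
theorem Filtration.exists_sub_gr_eq_bot [Finite W] {ι : Type*} {F : ι → GrMod (skewGr n W)}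
    {M : GrMod (skewGr n W)} (hM : M.FG) (Φ : Filtration F M) (d : ℤ) :
    ∃ i₀, ∀ i, i₀ ≤ i → ∀ j ≤ d, (M.sub (Φ.N i) (Φ.homog i)).gr j = ⊥ := by
  obtain ⟨b, hb⟩ := hM.exists_gr_eq_bot
  choose i₀ hi₀ using Φ.exists_inf_gr_eq_bot hM
  -- Below $b$ there is nothing to kill, so only the finitely many degrees from $b$ to $d$ constrain
  -- the index.
  refine ⟨(Finset.Icc b d).sup i₀, fun i hi j hj => (Submodule.eq_bot_iff _).2 fun x hx => ?_⟩
  have hx' : (x : Φ.N i).1 ∈ M.gr j := hx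
  refine Subtype.ext ?_
  rcases lt_or_ge j b with hjb | hjb
  · rwa [hb j hjb, Submodule.mem_bot] at hx'
  · exact hi₀ j i ((Finset.le_sup (f := i₀) (Finset.mem_Icc.2 ⟨hjb, hj⟩)).trans hi) _
      (x : Φ.N i).2 hx'

end GrMod

end Finiteness

/-- A sequence of natural numbers that vanishes in low degrees is a Laurent series. -/
theorem exists_isSeriesOf {c c' : ℤ → ℕ∞} (h : ∀ d, ∃ k : ℕ, c d = k ∧ c' d = k)
    (b : ℤ) (hb : ∀ d < b, c d = 0) :
    ∃ f : LaurentSeries ℤ, IsSeriesOf f c ∧ IsSeriesOf f c' := by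
  choose k hk hk' using h
  refine ⟨HahnSeries.ofSuppBddBelow (fun d => (k d : ℤ)) ⟨b, fun d hd => ?_⟩,
    fun d => ⟨k d, rfl, hk d⟩, fun d => ⟨k d, rfl, hk' d⟩⟩
  by_contra hlt
  have h1 := hb d (not_le.1 hlt)
  rw [hk] at h1
  exact hd (by simpa using h1)

noncomputable section

open TensorProduct Representation

namespace GrMod

/-! ### Homs out of $P_\lambda$, duals and multiplicities -/

section Standard

theorem one_mem_polyGr {n : ℕ} : (1 : PolyRing n) ∈ polyGr n 0 :=
  MvPolynomial.isWeightedHomogeneous_one ℂ _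

theorem single_mul_single_one {n : ℕ} {W : Type u} [Group W]
    [MulSemiringAction W (PolyRing n)] (w : W) (s : PolyRing n) :
    (SkewMonoidAlgebra.single w s : SkewAlg n W) =
      SkewMonoidAlgebra.single 1 s * SkewMonoidAlgebra.single w 1 := by
  rw [SkewMonoidAlgebra.single_mul_single, one_mul, one_smul, mul_one]

variable {n : ℕ} {W : Type u} [Group W] [MulSemiringAction W (PolyRing n)]
  [SMulCommClass W ℂ (PolyRing n)]

/-- A `ℂ`-linear map is linear over the skew group algebra if it commutes with `S` and `W`. -/
def homOfSkew {X Y : GrMod (skewGr n W)} (f : X →ₗ[ℂ] Y)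
    (h : ∀ (w : W) (s : PolyRing n) (x : X), f ((SkewMonoidAlgebra.single w s : SkewAlg n W) • x) =
      (SkewMonoidAlgebra.single w s : SkewAlg n W) • f x) : X →ₗ[SkewAlg n W] Y where
  toFun := f
  map_add' := map_add f
  map_smul' a x := by
    induction a using SkewMonoidAlgebra.induction_on with
    | zero => rw [zero_smul, map_zero, RingHom.id_apply, zero_smul]
    | add a b ha hb => rw [add_smul, map_add, ha, hb, RingHom.id_apply, RingHom.id_apply,
        RingHom.id_apply, add_smul]
    | single w s => exact h w s x

theorem ofSkew_single_smul {M : Type u} [AddCommGroup M] [Module ℂ M] {gr : ℤ → Submodule ℂ M}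
    {internal : DirectSum.IsInternal gr} {f : PolyRing n →ₐ[ℂ] Module.End ℂ M}
    {g : W →* Module.End ℂ M} {comm : ∀ (s : PolyRing n) (w : W), f (w • s) * g w = g w * f s}
    {hf : ∀ i j, ∀ s ∈ polyGr n i, ∀ m ∈ gr j, f s m ∈ gr (i + j)}
    {hg : ∀ w j, ∀ m ∈ gr j, g w m ∈ gr j} (w : W) (s : PolyRing n)
    (m : ofSkew M gr internal f g comm hf hg) :
    (SkewMonoidAlgebra.single w s : SkewAlg n W) • m = f s (g w m) :=
  have h : SkewMonoidAlgebra.liftNCRingHom (f : PolyRing n →+* Module.End ℂ M) g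
      (fun {s w} => comm s w) (SkewMonoidAlgebra.single w s) = f s * g w :=
    SkewMonoidAlgebra.liftNC_single _ _ _ _
  LinearMap.congr_fun h m

/-- The elements $1\otimes w$ have degree $0$. This makes the projection to $M_d$ equivariant, as
the inverse of `dualFlip` requires. -/
theorem proj_single_smul (M : GrMod (skewGr n W)) (d : ℤ) (w : W) (m : M) :
    M.proj d ((SkewMonoidAlgebra.single w 1 : SkewAlg n W) • m) =
      (SkewMonoidAlgebra.single w 1 : SkewAlg n W) • M.proj d m := by
  let T : M →ₗ[ℂ] M := Algebra.lsmul ℂ ℂ M (SkewMonoidAlgebra.single w 1 : SkewAlg n W)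
  have hT : ∀ i, ∀ x ∈ M.gr i, T x ∈ M.gr i := fun i x hx => by
    have := M.smul_mem (single_mem_skewGr (n := n) one_mem_polyGr w) hx
    rwa [zero_add] at this
  have : (⊤ : Submodule ℂ M) ≤ LinearMap.eqLocus (M.proj d ∘ₗ T) (T ∘ₗ M.proj d) := by
    rw [← iSup_gr M.internal]
    refine iSup_le fun j x hx => ?_
    by_cases hj : j = d
    · subst hj
      exact (gradedProj_same M.internal (hT _ x hx)).trans
        (congrArg T (gradedProj_same M.internal hx)).symm
    · exact (gradedProj_ne M.internal hj (hT _ x hx)).trans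
        ((congrArg T (gradedProj_ne M.internal hj hx)).trans (map_zero T)).symm
  exact this (x := m) trivial

variable [IsGradedAction n W]

variable (n) in
/-- The element `s ⊗ v` of `P_λ`. -/
def P.mk (l : Irr W) : PolyRing n →ₗ[ℂ] l.rep.V →ₗ[ℂ] P n l :=
  TensorProduct.mk ℂ (PolyRing n) l.rep.V

theorem P.induction_on {l : Irr W} {p : P n l → Prop} (x : P n l) (zero : p 0)
    (mk : ∀ s v, p (P.mk n l s v)) (add : ∀ x y, p x → p y → p (x + y)) : p x :=
  TensorProduct.induction_on (motive := p) x zero mk add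

theorem P.single_smul_mk (l : Irr W) (w : W) (t s : PolyRing n) (v : l.rep.V) :
    (SkewMonoidAlgebra.single w t : SkewAlg n W) • P.mk n l s v =
      P.mk n l (t * w • s) (l.rep.ρ w v) := by
  exact ofSkew_single_smul w t (P.mk n l s v)

theorem P.single_smul_mk_one (l : Irr W) (s : PolyRing n) (v : l.rep.V) :
    (SkewMonoidAlgebra.single 1 s : SkewAlg n W) • P.mk n l 1 v = P.mk n l s v := by
  rw [P.single_smul_mk, smul_one, mul_one, map_one]
  rfl

theorem P.mk_one_mem (l : Irr W) (v : l.rep.V) : P.mk n l 1 v ∈ (P n l).gr 0 :=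
  ⟨(⟨1, one_mem_polyGr⟩ : polyGr n 0) ⊗ₜ[ℂ] v, rfl⟩

/-- `Hom_A(P_λ, N)_e → Hom_W(λ, N_e)`. -/
def P.restrict (l : Irr W) (N : GrMod (skewGr n W)) (e : ℤ) :
    homDeg (P n l) N e →ₗ[ℂ] IntertwiningMap l.rep.ρ (N.compRep e) where
  toFun f := LinearMap.intertwiningMap_of_isIntertwiningMap _ _
    (LinearMap.codRestrict (N.gr e) (f.1.restrictScalars ℂ ∘ₗ P.mk n l 1) fun v => by
      have := f.2 0 _ (P.mk_one_mem l v)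
      rwa [zero_add] at this)
    fun w v => Subtype.ext (by
      change f.1 (P.mk n l 1 (l.rep.ρ w v)) =
        (SkewMonoidAlgebra.single w 1 : SkewAlg n W) • f.1 (P.mk n l 1 v)
      rw [← map_smul, P.single_smul_mk, smul_one, mul_one])
  map_add' _ _ := rfl
  map_smul' _ _ := rfl

/-- Frobenius reciprocity: $P_\lambda$ is the module induced from $\lambda$. The vectors $1\otimes
v$ generate it, and an intertwiner $\varphi$ extends by $s\otimes v\mapsto s\,\varphi(v)$. -/
theorem P.restrict_bijective (l : Irr W) (N : GrMod (skewGr n W)) (e : ℤ) :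
    Function.Bijective (P.restrict l N e) := by
  constructor
  · intro f g h
    refine Subtype.ext (LinearMap.ext fun x => ?_)
    induction x using P.induction_on with
    | zero => rw [map_zero, map_zero]
    | add x y hx hy => rw [map_add, map_add, hx, hy]
    | mk s v =>
      have h1 : f.1 (P.mk n l 1 v) = g.1 (P.mk n l 1 v) :=
        congrArg (fun φ : IntertwiningMap l.rep.ρ (N.compRep e) => (φ v : N)) h
      rw [← P.single_smul_mk_one, map_smul, map_smul, h1]
  · intro φ
    let B : PolyRing n →ₗ[ℂ] l.rep.V →ₗ[ℂ] N := LinearMap.mk₂ ℂ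
      (fun s v => (SkewMonoidAlgebra.single 1 s : SkewAlg n W) • (φ v : N))
      (fun s t v => by rw [SkewMonoidAlgebra.single_add, add_smul])
      (fun c s v => by rw [← SkewMonoidAlgebra.smul_single, smul_assoc])
      (fun s v v' => by rw [map_add, Submodule.coe_add, smul_add])
      (fun c s v => by rw [map_smul, Submodule.coe_smul, smul_comm])
    let F : P n l →ₗ[ℂ] N := TensorProduct.lift B
    have hF : ∀ s v, F (P.mk n l s v) =
        (SkewMonoidAlgebra.single 1 s : SkewAlg n W) • (φ v : N) := fun s v => rfl
    let G : P n l →ₗ[SkewAlg n W] N := homOfSkew F fun w t x => by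
      induction x using P.induction_on with
      | zero => rw [smul_zero, map_zero, smul_zero]
      | add x y hx hy => rw [smul_add, map_add, map_add, smul_add, hx, hy]
      | mk s v =>
        have h1 : (φ (l.rep.ρ w v) : N) =
            (SkewMonoidAlgebra.single w 1 : SkewAlg n W) • (φ v : N) :=
          congrArg Subtype.val (IntertwiningMap.isIntertwining _ _ φ w v)
        -- Equivariance of $\varphi$ reduces both sides to the action on $\varphi(v)$ of
        -- $t\,w(s)\otimes w=(t\otimes w)(s\otimes1)$.
        rw [P.single_smul_mk, hF, hF, h1, ← mul_smul, ← mul_smul, ← single_mul_single_one,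
          SkewMonoidAlgebra.single_mul_single, mul_one]
    refine ⟨⟨G, ?_⟩, ?_⟩
    · rintro i _ ⟨x, rfl⟩
      induction x with
      | zero => rw [map_zero]; exact (map_zero G).symm ▸ Submodule.zero_mem _
      | add a b ha hb =>
        rw [map_add]
        exact (map_add G _ _).symm ▸ Submodule.add_mem _ ha hb
      | tmul p v => exact N.smul_mem (single_mem_skewGr p.2 1) (φ v).2
    · refine IntertwiningMap.ext (LinearMap.ext fun v => Subtype.ext ?_)
      exact one_smul (SkewAlg n W) (φ v : N)

theorem rank_homDeg_P (l : Irr W) (N : GrMod (skewGr n W)) (e : ℤ) :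
    Module.rank ℂ (homDeg (P n l) N e) =
      Module.rank ℂ (IntertwiningMap l.rep.ρ (N.compRep e)) :=
  (LinearEquiv.ofBijective _ (P.restrict_bijective l N e)).rank_eq

theorem dual_smul_apply (M : GrMod (skewGr n W)) (w : W) (f : dual M) (m : M) :
    (((SkewMonoidAlgebra.single w 1 : SkewAlg n W) • f : dual M) : dualCarrier M).1 m =
      (f : dualCarrier M).1 ((SkewMonoidAlgebra.single w⁻¹ 1 : SkewAlg n W) • m) := by
  refine (congrArg (fun g : dualCarrier M => g.1 m) (ofSkew_single_smul w 1 f)).trans ?_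
  refine congrArg (fun x : M =>
    (f : dualCarrier M).1 ((SkewMonoidAlgebra.single w⁻¹ 1 : SkewAlg n W) • x)) ?_
  exact one_smul (SkewAlg n W) m

/-- `Hom_W(V, (M^*)_{-d}) → Hom_W(M_d, V^*)`. -/
def dualFlip {V : Type u} [AddCommGroup V] [Module ℂ V] (ρ : Representation ℂ W V)
    (M : GrMod (skewGr n W)) (d : ℤ) :
    IntertwiningMap ρ ((dual M).compRep (-d)) →ₗ[ℂ] IntertwiningMap (M.compRep d) ρ.dual where
  toFun φ := LinearMap.intertwiningMap_of_isIntertwiningMap _ _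
    (LinearMap.mk₂ ℂ (fun (m : M.gr d) (v : V) => ((φ v).1 : dualCarrier M).1 (m : M))
      (fun _ _ _ => map_add _ _ _) (fun _ _ _ => map_smul _ _ _)
      (fun _ _ _ => by rw [map_add]; rfl) (fun _ _ _ => by rw [map_smul]; rfl))
    fun w m => LinearMap.ext fun v => by
      have h1 : (φ (ρ w⁻¹ v)).1 = (SkewMonoidAlgebra.single w⁻¹ 1 : SkewAlg n W) • (φ v).1 :=
        congrArg Subtype.val (IntertwiningMap.isIntertwining _ _ φ w⁻¹ v)
      change ((φ v).1 : dualCarrier M).1 ((SkewMonoidAlgebra.single w 1 : SkewAlg n W) • (m : M)) =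
        ((φ (ρ w⁻¹ v)).1 : dualCarrier M).1 (m : M)
      rw [h1, dual_smul_apply, inv_inv]
  map_add' _ _ := rfl
  map_smul' _ _ := rfl

/-- Both sides are the $W$-invariant pairings of $M_d$ with $V$: a functional in $(M^*)_{-d}$ is
determined by its values on $M_d$. -/
theorem dualFlip_bijective {V : Type u} [AddCommGroup V] [Module ℂ V] (ρ : Representation ℂ W V)
    (M : GrMod (skewGr n W)) (d : ℤ) : Function.Bijective (dualFlip ρ M d) := by
  constructor
  · intro φ ψ h
    refine IntertwiningMap.ext (LinearMap.ext fun v => Subtype.ext (dual_ext fun j m hm => ?_))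
    by_cases hj : j = d
    · subst hj
      exact congrArg (fun χ : IntertwiningMap (M.compRep j) ρ.dual => χ ⟨m, hm⟩ v) h
    · have hj' : j ≠ - -d := by rwa [neg_neg]
      exact ((φ v).2 j hj' m hm).trans ((ψ v).2 j hj' m hm).symm
  · intro ψ
    -- Composing with `q` extends a functional on $M_d$ by zero to the other components, so it lands
    -- in $(M^*)_{-d}$.
    let q : M →ₗ[ℂ] M.gr d := (M.proj d).codRestrict (M.gr d) (gradedProj_mem M.internal d)
    have hq : ∀ j, j ≠ d → ∀ m ∈ M.gr j, q m = 0 := fun j hj m hm =>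
      Subtype.ext (gradedProj_ne M.internal hj hm)
    have hq' : ∀ m : M.gr d, q m = m := fun m => Subtype.ext (gradedProj_same M.internal m.2)
    have hqw : ∀ w m, q ((SkewMonoidAlgebra.single w 1 : SkewAlg n W) • m) =
        M.compRep d w (q m) := fun w m => Subtype.ext (proj_single_smul M d w m)
    let F : V →ₗ[ℂ] (dual M).gr (-d) :=
      { toFun := fun v => ⟨(⟨(ψ.toLinearMap.flip v) ∘ₗ q, {d}, fun j hj m hm => by
            rw [LinearMap.comp_apply, hq j (by simpa using hj) m hm, map_zero]⟩ : dualCarrier M),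
          fun j hj m hm => by
            change ψ.toLinearMap.flip v (q m) = 0
            rw [hq j (by rwa [neg_neg] at hj) m hm, map_zero]⟩
        map_add' := fun v v' => Subtype.ext (Subtype.ext (LinearMap.ext fun m =>
          map_add (ψ (q m)) v v'))
        map_smul' := fun c v => Subtype.ext (Subtype.ext (LinearMap.ext fun m =>
          map_smul (ψ (q m)) c v)) }
    refine ⟨LinearMap.intertwiningMap_of_isIntertwiningMap _ _ F fun w v =>
      Subtype.ext (Subtype.ext (LinearMap.ext fun m => ?_)), ?_⟩
    · change ψ (q m) (ρ w v) = _
      refine Eq.trans ?_ (dual_smul_apply M w (F v).1 m).symm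
      change _ = ψ (q _) v
      have h1 := LinearMap.congr_fun (IntertwiningMap.isIntertwining _ _ ψ w⁻¹ (q m)) v
      rw [hqw, h1]
      change _ = ψ (q m) (ρ w⁻¹⁻¹ v)
      rw [inv_inv]
    · refine IntertwiningMap.ext (LinearMap.ext fun m => LinearMap.ext fun v => ?_)
      change ψ (q m) v = ψ m v
      rw [hq']

theorem rank_intertwiningMap_eq_repMult [Finite W] {V : Type u} [AddCommGroup V] [Module ℂ V]
    [FiniteDimensional ℂ V] (σ : Representation ℂ W V) (l : Irr W) :
    Cardinal.toENat (Module.rank ℂ (IntertwiningMap σ l.rep.ρ)) = repMult σ l := by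
  have : l.rep.ρ.IsIrreducible := l.rep.irr
  have : IsSimpleModule (MonoidAlgebra ℂ W) l.rep.ρ.asModule := inferInstance
  have : FiniteDimensional ℂ σ.asModule := inferInstanceAs (FiniteDimensional ℂ V)
  have : FiniteDimensional ℂ l.rep.ρ.asModule := inferInstanceAs (FiniteDimensional ℂ l.rep.V)
  -- The order of $W$ is invertible in $\mathbb C$, so Maschke's theorem supplies semisimplicity.
  have : NeZero (Nat.card W : ℂ) := ⟨Nat.cast_ne_zero.2 Nat.card_pos.ne'⟩
  rw [(IntertwiningMap.equivLinearMapAsModule σ l.rep.ρ).rank_eq]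
  exact rank_linearMap_eq_length_isotypicComponent (k := ℂ) (R := MonoidAlgebra ℂ W)
    (V := σ.asModule) (S := l.rep.ρ.asModule)

/-- `dim Hom(P_λ, M^*)_{-d} = [M_d : λ]` for self-dual `λ`. -/
theorem rank_homDeg_P_dual [Finite W] (l : Irr W) (hl : Nonempty (l.rep.ρ.Equiv l.rep.ρ.dual))
    {M : GrMod (skewGr n W)} (hM : M.FG) (d : ℤ) :
    Cardinal.toENat (Module.rank ℂ (homDeg (P n l) (dual M) (-d))) = M.mult l d := by
  obtain ⟨e⟩ := hl
  have := hM.finiteDimensional_gr d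
  -- Self-duality enters here: composing with $\lambda\cong\lambda^*$ replaces $\lambda^*$ by
  -- $\lambda$ in the target.
  let E : IntertwiningMap (M.compRep d) l.rep.ρ.dual ≃ₗ[ℂ] IntertwiningMap (M.compRep d) l.rep.ρ :=
    LinearEquiv.ofLinearMap (IntertwiningMap.llcomp _ _ _ e.symm.toIntertwiningMap)
      (IntertwiningMap.llcomp _ _ _ e.toIntertwiningMap)
      (LinearMap.ext fun φ => IntertwiningMap.ext (LinearMap.ext fun m =>
        e.symm_apply_apply (φ m)))
      (LinearMap.ext fun φ => IntertwiningMap.ext (LinearMap.ext fun m =>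
        e.apply_symm_apply (φ m)))
  rw [rank_homDeg_P, (LinearEquiv.ofBijective _ (dualFlip_bijective l.rep.ρ M d)).rank_eq,
    E.rank_eq]
  exact rank_intertwiningMap_eq_repMult _ l

end Standard

end GrMod

end

/-! ### The multiplicity formula and reciprocity -/

theorem mainTheorem2 (n : ℕ) (W : Type u) [Group W] [Finite W]
    [MulSemiringAction W (PolyRing n)] [SMulCommClass W ℂ (PolyRing n)] [IsGradedAction n W]
    (selfDual : ∀ (V : Type u) [AddCommGroup V] [Module ℂ V] [FiniteDimensional ℂ V]
      (ρ : Representation ℂ W V), Nonempty (ρ.Equiv ρ.dual))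
    (finiteCoinvariants : FiniteDimensional ℂ (PolyRing n ⧸ coinvariantIdeal n W))
    [Preorder (Irr W)]
    (orthogonality : ∀ (l m : Irr W) (i : ℕ) (d : ℤ),
      ((i = 0 ∧ d = 0 ∧ l = m) →
        Nonempty (GrMod.Ext (GrMod.Ktilde n l) (GrMod.Ktilde_fg l)
          (GrMod.dual (GrMod.K n m)) i d ≃ₗ[ℂ] ℂ)) ∧
      (¬ (i = 0 ∧ d = 0 ∧ l = m) →
        Subsingleton (GrMod.Ext (GrMod.Ktilde n l) (GrMod.Ktilde_fg l)
          (GrMod.dual (GrMod.K n m)) i d))) :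
    (∀ M : GrMod (skewGr n W), M.FG →
      ∀ (Φ : GrMod.Filtration (GrMod.Ktilde n (W := W)) M) (m : Irr W),
        ∃ f : LaurentSeries ℤ,
          IsSeriesOf f (fun d => Φ.count m d) ∧
          IsSeriesOf f (fun d => Cardinal.toENat
            (Module.rank ℂ (GrMod.homDeg M (GrMod.dual (GrMod.K n m)) (-d))))) ∧
    (∀ (l : Irr W) (Φ : GrMod.Filtration (GrMod.Ktilde n (W := W)) (GrMod.P n l)) (m : Irr W),
        ∃ f : LaurentSeries ℤ,
          IsSeriesOf f (fun d => Φ.count m d) ∧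
          IsSeriesOf f (fun d => (GrMod.K n m).mult l d)) := by
  have hExt0 : ∀ (m l : Irr W) (k : ℤ),
      (k = 0 ∧ l = m → Module.rank ℂ
        (GrMod.homDeg (GrMod.Ktilde n l) (GrMod.dual (GrMod.K n m)) k) = 1) ∧
      (¬ (k = 0 ∧ l = m) → Module.rank ℂ
        (GrMod.homDeg (GrMod.Ktilde n l) (GrMod.dual (GrMod.K n m)) k) = 0) := by
    intro m l k
    obtain ⟨e⟩ := GrMod.nonempty_extZero (GrMod.Ktilde n l) (GrMod.Ktilde_fg l)
      (GrMod.dual (GrMod.K n m)) k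
    refine ⟨fun h => ?_, fun h => ?_⟩
    · obtain ⟨e'⟩ := (orthogonality l m 0 k).1 ⟨rfl, h⟩
      rw [Module.rank_eq_one_iff_finrank_eq_one, ← e.finrank_eq, e'.finrank_eq, Module.finrank_self]
    · have := (orthogonality l m 0 k).2 fun h' => h h'.2
      rw [← e.rank_eq]
      exact rank_subsingleton' ℂ _
  have hExt1 : ∀ (m l : Irr W) (k : ℤ), Subsingleton (GrMod.Ext (GrMod.Ktilde n l)
      (GrMod.Ktilde_fg l) (GrMod.dual (GrMod.K n m)) 1 k) := fun m l k =>
    (orthogonality l m 1 k).2 fun h => one_ne_zero h.1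
  -- $K_\mu$ is a quotient of $P_\mu$, which lives in degrees $\ge0$; dualizing reverses the sign.
  have hdual : ∀ (m : Irr W) (i : ℤ), 0 < i → (GrMod.dual (GrMod.K n m)).gr i = ⊥ := fun m i hi =>
    GrMod.dual_gr_eq_bot (GrMod.K_gr_eq_bot m (by omega))
  have first : ∀ M : GrMod (skewGr n W), M.FG →
      ∀ (Φ : GrMod.Filtration (GrMod.Ktilde n (W := W)) M) (m : Irr W),
        ∃ f : LaurentSeries ℤ,
          IsSeriesOf f (fun d => Φ.count m d) ∧
          IsSeriesOf f (fun d => Cardinal.toENat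
            (Module.rank ℂ (GrMod.homDeg M (GrMod.dual (GrMod.K n m)) (-d)))) := by
    intro M hM Φ m
    have key : ∀ d : ℤ, ∃ k : ℕ, Φ.count m d = k ∧
        Module.rank ℂ (GrMod.homDeg M (GrMod.dual (GrMod.K n m)) (-d)) = k := fun d => by
      obtain ⟨i₀, hi₀⟩ := Φ.exists_sub_gr_eq_bot hM d
      exact Φ.exists_count_eq_rank GrMod.Ktilde_fg (hExt0 m) (hExt1 m) hM d i₀ fun i hi =>
        GrMod.rank_homDeg_eq_zero (hi₀ i hi) (hdual m)
    obtain ⟨b, hb⟩ := hM.exists_gr_eq_bot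
    refine exists_isSeriesOf (fun d => ?_) b fun d hd => ?_
    · obtain ⟨k, h1, h2⟩ := key d
      exact ⟨k, h1, by rw [h2]; exact map_natCast _ k⟩
    · obtain ⟨k, h1, h2⟩ := key d
      -- For $d<b$ the whole of $M$ lies in degrees $>d$, so the Hom space is zero and the common
      -- coefficient vanishes.
      rw [GrMod.rank_homDeg_eq_zero (fun i hi => hb i (by omega)) (hdual m)] at h2
      have h3 : k = 0 := by exact_mod_cast h2.symm
      rw [h1, h3, Nat.cast_zero]
  refine ⟨first, fun l Φ m => ?_⟩
  obtain ⟨f, hf, hf'⟩ := first (GrMod.P n l) (GrMod.P_fg l) Φ m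
  refine ⟨f, hf, ?_⟩
  have hmult : ∀ d, (GrMod.K n m).mult l d = Cardinal.toENat
      (Module.rank ℂ (GrMod.homDeg (GrMod.P n l) (GrMod.dual (GrMod.K n m)) (-d))) := fun d =>
    (GrMod.rank_homDeg_P_dual l (selfDual _ _) (GrMod.K_fg m) d).symm
  simpa only [hmult] using hf'
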